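/- A $\mathrm{MOD}_m$-circuit in the variables $x_1,\dots,x_n$ is a finite directed acyclic graph, possibly with multiple edges, with one designated root. Its nodes are called gates and its edges wires. The gates without incoming wires are the input gates, exactly one for each variable $x_i$. Every other gate (internal gate) is labelled with a set $R\subseteq\mathbb{Z}_m$ and outputs $1$ if the sum of the values on its incoming wires (with multiplicities), taken modulo $m$, lies in $R$, and $0$ otherwise. The circuit computes the Boolean function given by the value at the root. The size $|C|$ is the number of gates plus the number of wires, counted with multiplicities; the depth is the maximum number of wires on a path from an input gate to the root. The circuit is $\mathbf{Sym}_n$-symmetric if for every permutation $\pi$ of $\{1,\dots,n\}$ there is a permutation $\sigma$ of the gates that maps the input gate of $x_i$ to the input gate of $x_{\pi(i)}$ for all $i$, maps every internal gate to an internal gate with the same set $R$, and preserves the multiplicities of all wires. **Theorem 1.** Let $m\ge 6$ be an integer with exactly $r\ge 2$ distinct prime divisors. 1. Every family of $\mathbf{Sym}_n$-symmetric $\mathrm{MOD}_m$-circuits $(C_n)_{n}$ computing the Boolean functions $\mathrm{AND}_n$ has size $|C_n|\ge 2^{\Omega(n^{1/r}\log n)}$, with a constant that depends only on $m$. That is,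 there are $c>0$ and $N$ (depending only on $m$) such that for all $n\ge N$, every $\mathbf{Sym}_n$-symmetric $\mathrm{MOD}_m$-circuit $C$ that computes $\mathrm{AND}_n$ satisfies $|C|\ge 2^{c\,n^{1/r}\log n}$. 2. This is matched in depth $2$: there is a family $(C_n)_{n\ge 1}$ of $\mathbf{Sym}_n$-symmetric $\mathrm{MOD}_m$-circuits of depth $2$ such that $C_n$ computes $\mathrm{AND}_n$ and $|C_n|\le 2^{O(n^{1/r}\log n)}$ as $n\to\infty$. -/

import Mathlib

/-- A `MOD_m`-circuit in the variables `x_1, …, x_n` (indexed by `Fin n`): a finite DAG with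
multiedges and a designated root. The gates are the `n` input gates `Sum.inl i` (exactly one for
each variable) and the internal gates `Sum.inr j`; the internal gate `j` computes the operation
`MOD_m^R` with `R = accept j`. -/
structure ModCircuit (m n : ℕ) where
  /-- The index set of the internal gates. -/
  Inner : Type
  [fintypeInner : Fintype Inner]
  /-- The accepting set `R ⊆ ℤ/m` of each internal gate. -/
  accept : Inner → Set (ZMod m)
  /-- `wires g h` is the multiplicity of the wire from `g` to `h`
  (the value of `g` is an input of `h`). -/
  wires : Fin n ⊕ Inner → Fin n ⊕ Inner → ℕ
  /-- The gates without incoming wires are exactly the input gates. -/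
  no_incoming_iff : ∀ h, (∀ g, wires g h = 0) ↔ ∃ i, h = Sum.inl i
  /-- There is no directed cycle. -/
  acyclic : ∀ g, ¬ Relation.TransGen (fun a b => 0 < wires a b) g g
  /-- The output gate. -/
  root : Fin n ⊕ Inner

attribute [instance] ModCircuit.fintypeInner

namespace ModCircuit

variable {m n : ℕ}

/-- The set `V(C)` of gates. -/
abbrev Gate (C : ModCircuit m n) : Type := Fin n ⊕ C.Inner

/-- There is at least one wire from `g` to `h`. -/
def IsWire (C : ModCircuit m n) (g h : C.Gate) : Prop := 0 < C.wires g h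

theorem wellFounded_isWire (C : ModCircuit m n) : WellFounded C.IsWire := by
  have : Std.Irrefl (Relation.TransGen C.IsWire) := ⟨C.acyclic⟩
  have h : WellFounded (Relation.TransGen C.IsWire) :=
    Finite.wellFounded_of_trans_of_irrefl _
  exact Subrelation.wf (fun hab => Relation.TransGen.single hab) h

open Classical in
/-- The Boolean value computed at each gate under the assignment `x`. -/
noncomputable def eval (C : ModCircuit m n) (x : Fin n → Bool) : C.Gate → Bool :=
  C.wellFounded_isWire.fix fun g val =>
    match g, val with
    | Sum.inl i, _ => x i
    | Sum.inr j, val =>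
      decide ((∑ h : C.Gate,
        if hw : C.IsWire h (Sum.inr j) then
          (C.wires h (Sum.inr j) : ZMod m) * ((val h hw).toNat : ZMod m)
        else 0) ∈ C.accept j)

theorem eval_inl (C : ModCircuit m n) (x : Fin n → Bool) (i : Fin n) :
    C.eval x (Sum.inl i) = x i := by
  unfold eval
  rw [WellFounded.fix_eq]

open Classical in
/-- An internal gate outputs `1` iff the sum of its inputs modulo `m`, counted with the
multiplicities of the wires, lies in its accepting set. -/
theorem eval_inr (C : ModCircuit m n) (x : Fin n → Bool) (j : C.Inner) :
    C.eval x (Sum.inr j) = true ↔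
      (∑ h : C.Gate, (C.wires h (Sum.inr j) : ZMod m) * ((C.eval x h).toNat : ZMod m))
        ∈ C.accept j := by
  have key : (∑ h : C.Gate,
      if C.IsWire h (Sum.inr j) then
        (C.wires h (Sum.inr j) : ZMod m) * ((C.eval x h).toNat : ZMod m) else 0) =
      ∑ h : C.Gate, (C.wires h (Sum.inr j) : ZMod m) * ((C.eval x h).toNat : ZMod m) := by
    refine Finset.sum_congr rfl fun h _ => ?_
    by_cases hw : C.IsWire h (Sum.inr j)
    · rw [if_pos hw]
    · have h0 : C.wires h (Sum.inr j) = 0 := Nat.eq_zero_of_not_pos hw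
      rw [if_neg hw, h0]
      simp
  rw [← key]
  conv_lhs => unfold eval
  rw [WellFounded.fix_eq]
  simp only [dite_eq_ite, decide_eq_true_eq]
  rfl

/-- `C` computes `AND_n`. -/
def ComputesAND (C : ModCircuit m n) : Prop :=
  ∀ x : Fin n → Bool, C.eval x C.root = true ↔ ∀ i, x i = true

/-- The size `|C| = |V(C)| + |E(C)|`: the number of gates plus the number of wires,
counted with multiplicities. -/
def size (C : ModCircuit m n) : ℕ :=
  Fintype.card C.Gate + ∑ g : C.Gate, ∑ h : C.Gate, C.wires g h

/-- `C` has depth `d`: the maximum number of wires on a path from an input gate to the root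
is `d`. -/
def HasDepth (C : ModCircuit m n) (d : ℕ) : Prop :=
  IsGreatest {k : ℕ | ∃ p : RelSeries {e : C.Gate × C.Gate | C.IsWire e.1 e.2},
    (∃ i, p.head = Sum.inl i) ∧ p.last = C.root ∧ p.length = k} d

/-- The label of a gate: a variable for an input gate, the accepting set of its operation for
an internal gate. -/
def label (C : ModCircuit m n) : C.Gate → Fin n ⊕ Set (ZMod m) :=
  Sum.map id C.accept

/-- The permutation `σ` of the gates is a circuit automorphism that extends the permutation `π`
of the variables: it maps the input gate of `x_i` to the input gate of `x_{π i}`, preserves the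
operations of the internal gates and preserves the multiplicities of all wires. -/
def Extends (C : ModCircuit m n) (π : Equiv.Perm (Fin n)) (σ : Equiv.Perm C.Gate) : Prop :=
  (∀ g, C.label (σ g) = Sum.map π id (C.label g)) ∧
    ∀ g h, C.wires (σ g) (σ h) = C.wires g h

/-- `C` is `Γ`-symmetric: every `π ∈ Γ` extends to an automorphism of `C`. -/
def IsSymmetric (C : ModCircuit m n) (Γ : Subgroup (Equiv.Perm (Fin n))) : Prop :=
  ∀ π ∈ Γ, ∃ σ : Equiv.Perm C.Gate, C.Extends π σ

end ModCircuit

/-! Lower bound. In a symmetric circuit the variable permutations that lift to an automorphism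
fixing a given gate form a subgroup of index at most the number of gates. A subgroup of index at
most `2 ^ L`, with `16 * L + 12 ≤ n`, and below `n.choose k` leaves invariant a set `Ω` missing
fewer than `k` points and contains every 3-cycle on it (`exists_invariant_of_index_lt_choose`).

Place a block of `M` variables inside the set `Ω` of the root, where for every prime power `p ^ a`
exactly dividing `m` the number `M` is a multiple of `2 * p ^ (a + f)` with `p ^ f ≥ k`. Flipping
the block, when its bits are all equal, is invisible to the root (`eval_eq_of_alternatingGroup_le`).
Indeed, let the alternating group of the block stabilize a gate. An even cyclic shift of order `p ^
(a + f)` lifts to an automorphism that fixes this gate and permutes its inputs. Orbits of inputs of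
length divisible by `p ^ a` change the sum by a multiple of `p ^ a`. If the length `l` is not so
divisible, the `l`-th power of the shift stabilizes the input, and its orbits on the block have at
least `p ^ f ≥ k` points. Hence the block lies inside the invariant set of that input, whose value
is unchanged by induction. So the circuit confuses the all-ones assignment with the one that is zero
on the block. Since `M` can be taken `O(k ^ r)`, the choice `k ≈ n ^ (1 / r)` is possible, and the
size is at least about `n.choose k`.

Upper bound. Choose powers `D p` of the primes `p ∣ m`, each of order `n ^ (1 / r)`, with product
above `n`. The number `z` of zeros of the assignment is `0` iff every `D p` divides it. Modulo `p`,
the indicator of `D p ∣ z` is the sum of `(-1) ^ |S|` over the sets `S` of zeros with `|S| < D p`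
(`sum_range_neg_one_pow_mul_choose`). The condition that `S` consists of zeros is expressed by
linear forms modulo another prime divisor `q` of `m`, which is invertible modulo `p`
(`sum_formSupport_eq`). The weights `m / p` let a single root gate test all primes at once
(`natCast_dvd_sum_div_mul_iff`). -/

/-! ### Three-cycles and commutators. -/

open Equiv in
/-- The `3`-cycle `a ↦ b ↦ c ↦ a`. -/
abbrev threeCycle {α : Type*} [DecidableEq α] (a b c : α) : Perm α := swap a b * swap b c

section ThreeCycles

open Equiv

variable {α : Type*} [DecidableEq α]

theorem threeCycle_apply_left {a b c : α} (hab : a ≠ b) (hac : a ≠ c) :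
    threeCycle a b c a = b := by
  simp [swap_apply_of_ne_of_ne hab hac]

theorem threeCycle_apply_middle {a b c : α} (hac : a ≠ c) (hbc : b ≠ c) :
    threeCycle a b c b = c := by
  simp [swap_apply_of_ne_of_ne hac.symm hbc.symm]

theorem threeCycle_apply_right {a b c : α} : threeCycle a b c c = a := by
  simp

theorem threeCycle_apply_of_ne {a b c x : α} (ha : x ≠ a) (hb : x ≠ b) (hc : x ≠ c) :
    threeCycle a b c x = x := by
  simp [swap_apply_of_ne_of_ne, ha, hb, hc]

theorem conj_threeCycle (g : Perm α) (a b c : α) :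
    g * threeCycle a b c * g⁻¹ = threeCycle (g a) (g b) (g c) := by
  rw [threeCycle, threeCycle, swap_apply_apply, swap_apply_apply]
  group

theorem inv_threeCycle {a b c : α} (hab : a ≠ b) (hac : a ≠ c) (hbc : b ≠ c) :
    (threeCycle a b c)⁻¹ = threeCycle b a c := by
  rw [inv_eq_iff_mul_eq_one]
  ext x
  simp only [threeCycle, Perm.mul_apply, Perm.one_apply, swap_apply_def]
  split_ifs <;> grind

theorem threeCycle_rotate {a b c : α} (hab : a ≠ b) (hac : a ≠ c) (hbc : b ≠ c) :
    threeCycle a b c = threeCycle b c a := by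
  ext x
  simp only [threeCycle, Perm.mul_apply, swap_apply_def]
  split_ifs <;> grind

/-- Two permutations that both move `v` and no other common point have a `3`-cycle as
commutator. -/
theorem commutator_eq_threeCycle {f g : Perm α} {v : α} (hf : f v ≠ v) (hg : g v ≠ v)
    (hfg : ∀ x, x ≠ v → f x = x ∨ g x = x) :
    f * g * f⁻¹ * g⁻¹ = threeCycle (g v) v (f v) := by
  have hgf : g (f v) = f v := (hfg _ hf).resolve_left fun h => hf (f.injective h)
  have hfg' : f (g v) = g v := (hfg _ hg).resolve_right fun h => hg (g.injective h)
  have hne : g v ≠ f v := fun h => hg (g.injective (by rw [h, hgf]))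
  suffices h : f * g = threeCycle (g v) v (f v) * (g * f) by rw [h]; group
  ext x
  change f (g x) = threeCycle (g v) v (f v) (g (f x))
  rcases eq_or_ne x v with rfl | hxv
  · rw [hgf, hfg', threeCycle_apply_right]
  rcases hfg x hxv with hx | hx
  · rw [hx]
    rcases eq_or_ne (g x) v with h | h
    · rw [h, threeCycle_apply_middle hne hf.symm]
    · rw [threeCycle_apply_of_ne (fun h' => hxv (g.injective h')) h]
      · rcases hfg _ h with h' | h'
        · exact h'
        · rw [g.injective h', hx]
      · intro h'
        have hxf : x = f v := g.injective (h'.trans hgf.symm)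
        exact hxv (f.injective (hx.trans hxf))
  · rw [hx]
    rcases eq_or_ne (f x) v with h | h
    · rw [h, threeCycle_apply_left hg hne]
    · have hy : g (f x) = f x := by
        rcases hfg _ h with h1 | h1
        · rw [f.injective h1, hx]
        · exact h1
      rw [hy, threeCycle_apply_of_ne _ h fun h' => hxv (f.injective h')]
      intro h'
      have hxg : x = g v := f.injective (h'.trans hfg'.symm)
      exact hxv (g.injective (hx.trans hxg))

end ThreeCycles

/-! ### The equivalence relation generated by the 3-cycles of a subgroup. -/

section Relation

open Equiv

variable {α : Type*} [DecidableEq α]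

/-- Two points are related by `H` if they are equal or moved by a common `3`-cycle in `H`. -/
def ThreeCycleRel (H : Subgroup (Perm α)) (u v : α) : Prop :=
  u = v ∨ u ≠ v ∧ ∃ w, u ≠ w ∧ v ≠ w ∧ threeCycle u v w ∈ H

variable {H : Subgroup (Perm α)}

theorem ThreeCycleRel.refl (u : α) : ThreeCycleRel H u u := Or.inl rfl

theorem ThreeCycleRel.symm {u v : α} (h : ThreeCycleRel H u v) : ThreeCycleRel H v u := by
  rcases h with h | ⟨huv, w, huw, hvw, h⟩
  · exact Or.inl h.symm
  · exact Or.inr ⟨huv.symm, w, hvw, huw, inv_threeCycle huv huw hvw ▸ H.inv_mem h⟩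

theorem ThreeCycleRel.map {u v : α} (h : ThreeCycleRel H u v) {g : Perm α} (hg : g ∈ H) :
    ThreeCycleRel H (g u) (g v) := by
  rcases h with h | ⟨huv, w, huw, hvw, h⟩
  · exact Or.inl (h ▸ rfl)
  · exact Or.inr ⟨g.injective.ne huv, g w, g.injective.ne huw, g.injective.ne hvw,
      conj_threeCycle g u v w ▸ H.mul_mem (H.mul_mem hg h) (H.inv_mem hg)⟩

/-- A 3-cycle of `H` sending `v` to `x` and fixing `u` carries the pair `(u, v)` to `(u, x)`. If it
moves `u`, then it already contains both `u` and `x`. -/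
theorem ThreeCycleRel.trans {u v x : α} (h₁ : ThreeCycleRel H u v) (h₂ : ThreeCycleRel H v x) :
    ThreeCycleRel H u x := by
  rcases h₂ with rfl | ⟨hvx, y, hvy, hxy, h⟩
  · exact h₁
  rcases eq_or_ne u v with rfl | huv
  · exact Or.inr ⟨hvx, y, hvy, hxy, h⟩
  rcases eq_or_ne u x with rfl | hux
  · exact .refl _
  rcases eq_or_ne u y with rfl | huy
  · refine Or.inr ⟨hux, v, huv, hvx.symm, ?_⟩
    have h' := H.inv_mem h
    rw [inv_threeCycle hvx hvy hxy, threeCycle_rotate hvx.symm hxy hvy,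
      threeCycle_rotate hvy hvx hux] at h'
    exact h'
  have := h₁.map h
  rwa [threeCycle_apply_of_ne huv hux huy, threeCycle_apply_left hvx hvy] at this

/-- Start from some `(a b d)` in `H`. Since `d` is related to `c`, there is `(d c e)` in `H`, and
conjugating by it replaces `d` by `c`. When `e` is `a` or `b` it is `(d c e)` that gets conjugated
instead, by `(a b d)` or its inverse. -/
theorem threeCycle_mem_of_rel {a b c : α} (hab : a ≠ b) (hac : a ≠ c) (hbc : b ≠ c)
    (h₁ : ThreeCycleRel H a b) (h₂ : ThreeCycleRel H a c) : threeCycle a b c ∈ H := by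
  obtain ⟨d, had, hbd, h⟩ := (h₁.resolve_left hab).2
  rcases eq_or_ne d c with rfl | hdc
  · exact h
  have hda : ThreeCycleRel H d a := by
    refine Or.inr ⟨had.symm, b, hbd.symm, hab, ?_⟩
    rwa [threeCycle_rotate had.symm hbd.symm hab]
  obtain ⟨e, hde, hce, h'⟩ := ((hda.trans h₂).resolve_left hdc).2
  have key : ∀ g ∈ H, ∀ x y z, threeCycle x y z ∈ H → threeCycle (g x) (g y) (g z) ∈ H :=
    fun g hg x y z hx => conj_threeCycle g x y z ▸ H.mul_mem (H.mul_mem hg hx) (H.inv_mem hg)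
  rcases eq_or_ne e a with rfl | hea
  · have := key _ h _ _ _ h'
    rw [threeCycle_apply_right, threeCycle_apply_of_ne hac.symm hbc.symm hdc.symm,
      threeCycle_apply_left hab had] at this
    have := H.inv_mem this
    rw [inv_threeCycle hac hab hbc.symm, threeCycle_rotate hac.symm hbc.symm hab] at this
    exact this
  rcases eq_or_ne e b with rfl | heb
  · have := key _ (H.inv_mem h) _ _ _ h'
    rw [inv_threeCycle hab had hbd] at this
    rw [threeCycle_apply_right, threeCycle_apply_of_ne hbc.symm hac.symm hdc.symm,
      threeCycle_apply_left hab.symm hbd] at this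
    rw [threeCycle_rotate hab hac hbc]
    exact this
  · have := key _ h' _ _ _ h
    rwa [threeCycle_apply_of_ne had hac hea.symm, threeCycle_apply_of_ne hbd hbc heb.symm,
      threeCycle_apply_left hdc hde] at this

/-- If `H` contains all `3`-cycles on the range of an embedding, it contains the image of the
alternating group. -/
theorem alternatingGroup_le_comap_viaEmbeddingHom {β : Type*} [Fintype β] [DecidableEq β]
    (ι : β ↪ α)
    (h : ∀ a b c, a ≠ b → a ≠ c → b ≠ c → threeCycle (ι a) (ι b) (ι c) ∈ H) :
    alternatingGroup β ≤ H.comap (Perm.viaEmbeddingHom ι) := by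
  rw [← Perm.closure_three_cycles_eq_alternating, Subgroup.closure_le]
  intro g hg
  obtain ⟨a, b, c, hab, hac, hbc, rfl⟩ : ∃ a b c, a ≠ b ∧ a ≠ c ∧ b ≠ c ∧ g = threeCycle a b c := by
    have hg3 : g.IsThreeCycle := hg
    obtain ⟨a, ha⟩ := hg3.isCycle.nonempty_support
    have h1 := (Perm.IsThreeCycle.nodup_iff_mem_support hg3).2 ha
    have h2 := (Perm.IsThreeCycle.eq_swap_mul_swap_iff_mem_support hg3).2 ha
    simp only [List.nodup_cons, List.mem_cons, List.not_mem_nil, or_false, not_or] at h1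
    exact ⟨a, g a, g (g a), h1.1.1, h1.1.2, h1.2.1, h2⟩
  have : Perm.viaEmbedding (threeCycle a b c) ι = threeCycle (ι a) (ι b) (ι c) := by
    ext x
    by_cases hx : x ∈ Set.range ι
    · obtain ⟨y, rfl⟩ := hx
      rw [Perm.viaEmbedding_apply]
      simp only [threeCycle, Perm.mul_apply, swap_apply_def]
      split_ifs <;> simp_all
    · rw [Perm.viaEmbedding_apply_of_notMem _ _ _ hx, threeCycle_apply_of_ne] <;>
      exact fun h => hx ⟨_, h.symm⟩
  change Perm.viaEmbedding _ ι ∈ H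
  rw [this]
  exact h a b c hab hac hbc

end Relation

/-! ### Counting the elements of a small-index subgroup by support. -/

section Counting

open Equiv

variable {α : Type*}

/-- The elements of `H` that move only points of `T`. -/
def supportedIn (H : Subgroup (Perm α)) (T : Finset α) : Set (Perm α) :=
  {g | g ∈ H ∧ ∀ x, x ∉ T → g x = x}

variable {H : Subgroup (Perm α)} {T : Finset α}

theorem apply_mem_of_mem_supportedIn {g : Perm α} (hg : g ∈ supportedIn H T) {x : α}
    (hx : x ∈ T) : g x ∈ T := by
  by_contra h
  exact h (by rwa [g.injective (hg.2 _ h)])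

theorem ncard_supportedIn_empty : (supportedIn H (∅ : Finset α)).ncard = 1 := by
  rw [Set.ncard_eq_one]
  refine ⟨1, Set.eq_singleton_iff_unique_mem.2 ⟨⟨H.one_mem, fun _ _ => rfl⟩, fun g hg => ?_⟩⟩
  ext x
  exact hg.2 x (Finset.notMem_empty x)

variable [Fintype α]

theorem ncard_supportedIn_pos : 0 < (supportedIn H T).ncard :=
  (Set.ncard_pos (Set.toFinite _)).2 ⟨1, H.one_mem, fun _ _ => rfl⟩

open Classical in
-- Each fibre of `g ↦ g v` is a translate of a set of elements that fix `v`, and these are supported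
-- in `T`.
theorem ncard_supportedIn_insert_le {v : α} {O : Finset α}
    (hO : ∀ g ∈ supportedIn H (insert v T), g v ∈ O) :
    (supportedIn H (insert v T)).ncard ≤ O.card * (supportedIn H T).ncard := by
  rw [Set.ncard_eq_toFinset_card', mul_comm]
  refine Finset.card_le_mul_card_image_of_maps_to (f := fun g : Perm α => g v) (t := O)
    (fun g hg => hO g (Set.mem_toFinset.1 hg)) _ fun w _ => ?_
  rcases Finset.eq_empty_or_nonempty
    ((supportedIn H (insert v T)).toFinset.filter fun g => g v = w) with h | ⟨g₀, hg₀⟩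
  · rw [h]; simp
  rw [Finset.mem_filter, Set.mem_toFinset] at hg₀
  rw [Set.ncard_eq_toFinset_card' (supportedIn H T)]
  refine Finset.card_le_card_of_injOn (fun g => g₀⁻¹ * g) (fun g hg => ?_)
    fun g _ g' _ h => mul_left_cancel h
  rw [Finset.mem_coe, Finset.mem_filter, Set.mem_toFinset] at hg
  rw [Finset.mem_coe, Set.mem_toFinset]
  refine ⟨H.mul_mem (H.inv_mem hg₀.1.1) hg.1.1, fun x hx => ?_⟩
  rw [Perm.mul_apply, Perm.inv_eq_iff_eq]
  rcases eq_or_ne x v with rfl | hxv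
  · rw [hg.2, hg₀.2]
  · rw [hg.1.2 x (by simp [hxv, hx]), hg₀.1.2 x (by simp [hxv, hx])]

theorem ncard_supportedIn_insert_le_succ [DecidableEq α] {v : α} (hv : v ∉ T) :
    (supportedIn H (insert v T)).ncard ≤ (T.card + 1) * (supportedIn H T).ncard := by
  classical
  rw [← Finset.card_insert_of_notMem hv]
  convert ncard_supportedIn_insert_le (T := T) (v := v) (O := insert v T) (H := H) ?_
  intro g hg
  convert apply_mem_of_mem_supportedIn hg (x := v) (by simp)

/-- The elements of `H` supported in `T` have index at most that of `H` among all permutations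
supported in `T`. -/
theorem factorial_card_le_index_mul (T : Finset α) :
    T.card.factorial ≤ H.index * (supportedIn H T).ncard := by
  classical
  induction hk : (Tᶜ).card generalizing T with
  | zero =>
    have hT : T = Finset.univ := by
      rwa [Finset.card_eq_zero, Finset.compl_eq_empty_iff] at hk
    have h : (supportedIn H T).ncard = Nat.card H := by
      subst hT
      rw [← Nat.card_coe_set_eq]
      exact Nat.card_congr (Equiv.subtypeEquivRight fun g => by simp [supportedIn])
    rw [h, H.index_mul_card, Nat.card_eq_fintype_card, Fintype.card_perm, hT, Finset.card_univ]
  | succ k ih =>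
    obtain ⟨v, hv⟩ : (Tᶜ).Nonempty := Finset.card_pos.1 (by omega)
    rw [Finset.mem_compl] at hv
    have hk' : ((insert v T)ᶜ).card = k := by
      rw [Finset.card_compl, Finset.card_insert_of_notMem hv]
      rw [Finset.card_compl] at hk
      omega
    have h1 := ih _ hk'
    rw [Finset.card_insert_of_notMem hv, Nat.factorial_succ] at h1
    have h2 := h1.trans (Nat.mul_le_mul_left _ (ncard_supportedIn_insert_le_succ (H := H) hv))
    rw [mul_left_comm] at h2
    exact Nat.le_of_mul_le_mul_left h2 (Nat.succ_pos _)

/-- Points of `T` that are fixed by every element of `H` moving only points of `T` up to them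
save factors of two in the number of elements of `H` supported in `T`. -/
theorem ncard_supportedIn_mul_two_pow_le (f : α → ℤ) (H : Subgroup (Perm α))
    (T B : Finset α)
    (hBT : B ⊆ T)
    (hB : ∀ v ∈ B, ∀ g ∈ H, (∀ x, ¬(x ∈ T ∧ f x ≤ f v) → g x = x) → g v = v) :
    (supportedIn H T).ncard * 2 ^ B.card ≤ 2 * T.card.factorial := by
  classical
  induction T using Finset.induction_on_max_value f generalizing B with
  | empty =>
    rw [Finset.subset_empty.1 hBT, ncard_supportedIn_empty]
    simp
  | insert v T hv hle ih =>
    have ih' := ih (B.erase v) (fun x hx => by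
      rw [Finset.mem_erase] at hx
      exact (Finset.mem_insert.1 (hBT hx.2)).resolve_left hx.1) (fun u hu g hg hgx => by
        rw [Finset.mem_erase] at hu
        have huT : u ∈ T := (Finset.mem_insert.1 (hBT hu.2)).resolve_left hu.1
        refine hB u hu.2 g hg fun x hx => hgx x fun h => hx ⟨Finset.mem_insert_of_mem h.1, h.2⟩)
    rw [Finset.card_insert_of_notMem hv, Nat.factorial_succ]
    by_cases hvB : v ∈ B
    -- As `v` has maximal `f`-value, every element supported in `insert v T` satisfies the premise
    -- of `hB`, hence fixes `v`.
    · have hle' : (supportedIn H (insert v T)).ncard ≤ 1 * (supportedIn H T).ncard := by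
        rw [← Finset.card_singleton v]
        convert ncard_supportedIn_insert_le (T := T) (v := v) (O := {v}) (H := H) ?_
        intro g hg
        rw [Finset.mem_singleton]
        refine hB v hvB g hg.1 fun x hx => hg.2 x fun hx' => hx ⟨?_, ?_⟩
        · convert hx'
        · rcases Finset.mem_insert.1 hx' with rfl | h
          · exact le_rfl
          · exact hle x h
      rw [one_mul] at hle'
      rw [← Finset.card_erase_add_one hvB]
      -- The count stays the same while the factorial gains `T.card + 1 ≥ 2`, except at the first
      -- point; the constant `2` in the bound pays for that one.
      rcases T.eq_empty_or_nonempty with rfl | hT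
      · have : B.erase v = ∅ := by
          rw [← Finset.subset_empty]
          intro x hx
          rw [Finset.mem_erase] at hx
          simpa [hx.1] using hBT hx.2
        rw [this]
        rw [ncard_supportedIn_empty] at hle'
        simpa using hle'
      · have := hT.card_pos
        calc _ ≤ (supportedIn H T).ncard * 2 ^ ((B.erase v).card + 1) := by gcongr
          _ = 2 * ((supportedIn H T).ncard * 2 ^ (B.erase v).card) := by ring
          _ ≤ 2 * (2 * T.card.factorial) := by gcongr
          _ ≤ _ := by nlinarith [T.card.factorial_pos]
    · rw [Finset.erase_eq_of_notMem hvB] at ih'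
      calc _ ≤ ((T.card + 1) * (supportedIn H T).ncard) * 2 ^ B.card := by
            gcongr
            exact ncard_supportedIn_insert_le_succ hv
        _ = (T.card + 1) * ((supportedIn H T).ncard * 2 ^ B.card) := by ring
        _ ≤ (T.card + 1) * (2 * T.card.factorial) := by gcongr
        _ = _ := by ring

theorem card_le_of_fixed (f : α → ℤ) {L : ℕ} (hL : H.index ≤ 2 ^ L) (B : Finset α)
    (hBT : B ⊆ T)
    (hB : ∀ v ∈ B, ∀ g ∈ H, (∀ x, ¬(x ∈ T ∧ f x ≤ f v) → g x = x) → g v = v) :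
    B.card ≤ L + 1 := by
  have h1 := ncard_supportedIn_mul_two_pow_le f H T B hBT hB
  have h2 := factorial_card_le_index_mul (H := H) T
  have h3 : (supportedIn H T).ncard * 2 ^ B.card ≤ (supportedIn H T).ncard * 2 ^ (L + 1) :=
    calc _ ≤ 2 * T.card.factorial := h1
      _ ≤ 2 * (2 ^ L * (supportedIn H T).ncard) := by
        gcongr
        exact h2.trans (Nat.mul_le_mul_right _ hL)
      _ = _ := by ring
  exact (Nat.pow_le_pow_iff_right (by norm_num)).1
    (Nat.le_of_mul_le_mul_left h3 ncard_supportedIn_pos)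

/-- A large set contains a `3`-cycle of a subgroup of small index. -/
theorem exists_threeCycle_mem [DecidableEq α] {L : ℕ} (hL : H.index ≤ 2 ^ L)
    (hT : 2 * L + 2 < T.card) :
    ∃ u ∈ T, ∃ v ∈ T, ∃ w ∈ T, u ≠ v ∧ u ≠ w ∧ v ≠ w ∧ threeCycle u v w ∈ H := by
  classical
  let r : α → ℤ := fun x => (Fintype.equivFin α x : ℕ)
  have hr : Function.Injective r := fun x y h =>
    (Fintype.equivFin α).injective (Fin.ext (Int.ofNat_injective h))
  -- Apply the bound to an order and to its reverse. A point outside `B₁ ∪ B₂` is moved by some `f`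
  -- acting only below it and some `g` acting only above it, so the commutator of `f` and `g` is a
  -- 3-cycle.
  let B₁ := T.filter fun v => ∀ g ∈ H, (∀ x, ¬(x ∈ T ∧ r x ≤ r v) → g x = x) → g v = v
  let B₂ := T.filter fun v => ∀ g ∈ H, (∀ x, ¬(x ∈ T ∧ -r x ≤ -r v) → g x = x) → g v = v
  have h1 : B₁.card ≤ L + 1 :=
    card_le_of_fixed r hL B₁ (Finset.filter_subset _ _) fun v hv => (Finset.mem_filter.1 hv).2
  have h2 : B₂.card ≤ L + 1 :=
    card_le_of_fixed (fun x => -r x) hL B₂ (Finset.filter_subset _ _)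
      fun v hv => (Finset.mem_filter.1 hv).2
  have h3 : (B₁ ∪ B₂).card < T.card := by
    have := Finset.card_union_le B₁ B₂
    omega
  obtain ⟨v, hvT, hv⟩ := Finset.exists_mem_notMem_of_card_lt_card h3
  rw [Finset.mem_union, not_or, Finset.mem_filter, Finset.mem_filter] at hv
  obtain ⟨hv1, hv2⟩ := hv
  simp only [hvT, true_and, not_forall] at hv1 hv2
  obtain ⟨f, hf, hfx, hfv⟩ := hv1
  obtain ⟨g, hg, hgx, hgv⟩ := hv2
  have hfg : ∀ x, x ≠ v → f x = x ∨ g x = x := by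
    intro x hx
    rcases le_total (r x) (r v) with h | h
    · exact Or.inr (hgx x fun h' => hx (hr (le_antisymm h (neg_le_neg_iff.1 h'.2))))
    · exact Or.inl (hfx x fun h' => hx (hr (le_antisymm h'.2 h)))
  have hfT : f v ∈ T := by
    by_contra h
    exact hfv (f.injective (hfx (f v) fun h' => h h'.1))
  have hgT : g v ∈ T := by
    by_contra h
    exact hgv (g.injective (hgx (g v) fun h' => h h'.1))
  refine ⟨g v, hgT, v, hvT, f v, hfT, hgv, fun h => ?_, fun h => hfv h.symm, ?_⟩
  · rcases hfg _ hgv with h' | h'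
    · exact hfv (f.injective (by rw [← h, h']))
    · exact hgv (g.injective h')
  · have := commutator_eq_threeCycle hfv hgv hfg
    convert H.mul_mem (H.mul_mem (H.mul_mem hf hg) (H.inv_mem hf)) (H.inv_mem hg) using 1
    convert this.symm

end Counting

/-! ### A large invariant set of a small-index subgroup. -/

section Support

open Equiv

variable {α : Type*} [Fintype α] [DecidableEq α] {H : Subgroup (Perm α)}

open Classical in
/-- The points related to `v`. -/
noncomputable def threeCycleClass (H : Subgroup (Perm α)) (v : α) : Finset α :=
  Finset.univ.filter (ThreeCycleRel H v)

theorem mem_threeCycleClass {u v : α} : u ∈ threeCycleClass H v ↔ ThreeCycleRel H v u := by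
  simp [threeCycleClass]

theorem exists_transversal (H : Subgroup (Perm α)) :
    ∃ R : Finset α, (∀ v, ∃ u ∈ R, ThreeCycleRel H v u) ∧
      ∀ u ∈ R, ∀ v ∈ R, ThreeCycleRel H u v → u = v := by
  classical
  let S : Setoid α := ⟨ThreeCycleRel H, .refl, .symm, .trans⟩
  refine ⟨Finset.univ.image fun v => (Quotient.mk S v).out, fun v => ?_, ?_⟩
  · exact ⟨_, Finset.mem_image_of_mem _ (Finset.mem_univ v), S.symm (Quotient.mk_out v)⟩
  · intro u hu v hv huv
    obtain ⟨u, -, rfl⟩ := Finset.mem_image.1 hu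
    obtain ⟨v, -, rfl⟩ := Finset.mem_image.1 hv
    have h : Quotient.mk S (Quotient.mk S u).out = Quotient.mk S (Quotient.mk S v).out :=
      Quotient.sound huv
    rw [Quotient.out_eq, Quotient.out_eq] at h
    rw [h]

/-- A transversal `R` has at most `2 * L + 2` points, since it carries no 3-cycle of `H`. Elements
of `H` fixing `R` pointwise preserve every class, so adding a point `v` to the support multiplies
their number by at most the size of its class. If all classes had at most half the points, `H` would
be too small for its index. -/
theorem exists_card_lt_two_mul_card_threeCycleClass {L : ℕ} (hL : H.index ≤ 2 ^ L)
    (hn : 16 * L + 12 ≤ Fintype.card α) :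
    ∃ v, Fintype.card α < 2 * (threeCycleClass H v).card := by
  by_contra! hcl
  obtain ⟨R, hR, hRR⟩ := exists_transversal H
  have hRcard : R.card ≤ 2 * L + 2 := by
    by_contra! h
    obtain ⟨u, hu, v, hv, w, hw, huv, huw, hvw, hmem⟩ := exists_threeCycle_mem hL h
    exact huv (hRR u hu v hv (Or.inr ⟨huv, w, huw, hvw, hmem⟩))
  -- Beyond this many points, half of `Fintype.card α` is at most two thirds of `T.card + 1`, so
  -- every further point saves a factor `2 / 3`.
  set J := 3 * Fintype.card α / 4 with hJ
  have key : ∀ T : Finset α, T ⊆ Rᶜ →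
      (supportedIn H T).ncard * 3 ^ (T.card - J) ≤ 2 ^ (T.card - J) * T.card.factorial := by
    intro T
    induction T using Finset.induction_on with
    | empty => intro _; rw [ncard_supportedIn_empty]; simp
    | insert v T hv ih =>
      intro hT
      have ih := ih fun x hx => hT (Finset.mem_insert_of_mem hx)
      rw [Finset.card_insert_of_notMem hv, Nat.factorial_succ]
      by_cases hTJ : T.card + 1 ≤ J
      · rw [Nat.sub_eq_zero_of_le hTJ, pow_zero, pow_zero, mul_one, one_mul]
        rw [Nat.sub_eq_zero_of_le (by omega), pow_zero, pow_zero, mul_one, one_mul] at ih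
        exact (ncard_supportedIn_insert_le_succ hv).trans (Nat.mul_le_mul_left _ ih)
      · have hle : (supportedIn H (insert v T)).ncard ≤
            (threeCycleClass H v).card * (supportedIn H T).ncard := by
          convert ncard_supportedIn_insert_le (T := T) (v := v) (H := H) ?_
          intro g hg
          rw [mem_threeCycleClass]
          obtain ⟨u, hu, hvu⟩ := hR v
          have hgu : g u = u := hg.2 u fun h => by
            have h' : u ∈ insert v T := by convert h
            exact Finset.mem_compl.1 (hT h') hu
          have := hvu.map hg.1
          rw [hgu] at this
          exact hvu.trans this.symm
        have h3 : 3 * (threeCycleClass H v).card ≤ 2 * (T.card + 1) := by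
          have := hcl v
          omega
        rw [show T.card + 1 - J = (T.card - J) + 1 by omega]
        calc _ ≤ ((threeCycleClass H v).card * (supportedIn H T).ncard) *
                3 ^ (T.card - J + 1) := by gcongr
          _ = (3 * (threeCycleClass H v).card) *
                ((supportedIn H T).ncard * 3 ^ (T.card - J)) := by ring
          _ ≤ (2 * (T.card + 1)) * (2 ^ (T.card - J) * T.card.factorial) := by gcongr
          _ = _ := by ring
  have h1 := key _ le_rfl
  have h2 := factorial_card_le_index_mul (H := H) Rᶜ
  -- `16 * L + 12 ≤ n` leaves at least `(4 * L + 3) - (2 * L + 2)` saving points. This many suffice,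
  -- because `(3 / 2) ^ (2 * L + 1) > 2 ^ L` by `9 ^ L ≥ 8 ^ L`.
  obtain ⟨d, hd⟩ : ∃ d, (Rᶜ).card - J = 2 * L + 1 + d := by
    refine ⟨(Rᶜ).card - J - (2 * L + 1), ?_⟩
    rw [Finset.card_compl]
    omega
  rw [hd] at h1
  have h4 : (supportedIn H Rᶜ).ncard * 3 ^ (2 * L + 1 + d) ≤
      (supportedIn H Rᶜ).ncard * (2 ^ (2 * L + 1 + d) * 2 ^ L) :=
    calc _ ≤ 2 ^ (2 * L + 1 + d) * (Rᶜ).card.factorial := h1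
      _ ≤ 2 ^ (2 * L + 1 + d) * (2 ^ L * (supportedIn H Rᶜ).ncard) := by
        gcongr
        exact h2.trans (Nat.mul_le_mul_right _ hL)
      _ = _ := by ring
  have h5 := Nat.le_of_mul_le_mul_left h4 ncard_supportedIn_pos
  have h6 : 8 ^ L ≤ 9 ^ L := Nat.pow_le_pow_left (by norm_num) L
  have h7 : 2 ^ d ≤ 3 ^ d := Nat.pow_le_pow_left (by norm_num) d
  have h8 : 0 < 8 ^ L * 2 ^ d := by positivity
  have h9 : 8 ^ L * 2 ^ d ≤ 9 ^ L * 3 ^ d := Nat.mul_le_mul h6 h7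
  have e1 : 3 ^ (2 * L + 1 + d) = 3 * (9 ^ L * 3 ^ d) := by
    rw [pow_add, pow_add, pow_mul]; norm_num; ring
  have e2 : 2 ^ (2 * L + 1 + d) * 2 ^ L = 2 * (8 ^ L * 2 ^ d) := by
    rw [show (8 : ℕ) = 2 ^ 3 by norm_num, ← pow_mul]; ring
  omega

/-- `H` lies in the setwise stabilizer of `Ω`, whose index is this binomial coefficient. -/
theorem choose_card_le_index {Ω : Finset α} (hΩ : ∀ g ∈ H, ∀ x, g x ∈ Ω ↔ x ∈ Ω) :
    (Fintype.card α).choose Ω.card ≤ H.index := by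
  have h1 : Nat.card H ≤ Ω.card.factorial * (Fintype.card α - Ω.card).factorial := by
    have := DomMulAct.stabilizer_ncard (f := fun a : α => decide (a ∈ Ω))
    rw [Fintype.prod_bool] at this
    simp only [decide_eq_true_eq, decide_eq_false_iff_not] at this
    have e1 : Set.ncard {a | a ∈ Ω} = Ω.card := Set.ncard_coe_finset Ω
    have e2 : Set.ncard {a | a ∉ Ω} = Fintype.card α - Ω.card := by
      rw [← Finset.card_compl, ← Set.ncard_coe_finset]
      congr 1
      ext x
      simp
    rw [e1, e2] at this
    rw [← this, ← SetLike.coe_sort_coe, Nat.card_coe_set_eq]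
    refine Set.ncard_le_ncard (fun g hg => ?_) (Set.toFinite _)
    ext x
    simp [hΩ g hg x]
  have h2 := H.index_mul_card
  rw [Nat.card_eq_fintype_card (α := Perm α), Fintype.card_perm] at h2
  have h3 := Nat.choose_mul_factorial_mul_factorial (Finset.card_le_univ Ω)
  rw [mul_assoc, ← h2] at h3
  refine Nat.le_of_mul_le_mul_right (c := Ω.card.factorial * (Fintype.card α - Ω.card).factorial)
    ?_ (Nat.mul_pos (Nat.factorial_pos _) (Nat.factorial_pos _))
  rw [h3]
  exact Nat.mul_le_mul_left _ h1

/-- A subgroup of small index leaves a large set invariant and contains all `3`-cycles on it. -/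
theorem exists_invariant_of_index_lt_choose {L k : ℕ} (hL : H.index ≤ 2 ^ L)
    (hn : 16 * L + 12 ≤ Fintype.card α) (hk : H.index < (Fintype.card α).choose k) :
    ∃ Ω : Finset α, (Ωᶜ).card < k ∧ (∀ g ∈ H, ∀ x, g x ∈ Ω ↔ x ∈ Ω) ∧
      ∀ a ∈ Ω, ∀ b ∈ Ω, ∀ c ∈ Ω, a ≠ b → a ≠ c → b ≠ c → threeCycle a b c ∈ H := by
  obtain ⟨v, hv⟩ := exists_card_lt_two_mul_card_threeCycleClass hL hn
  set Ω := threeCycleClass H v with hΩ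
  have hmap : ∀ g ∈ H, ∀ x ∈ Ω, g x ∈ Ω := by
    intro g hg x hx
    -- A class with more than half of the points meets its image, and `H` permutes the classes.
    obtain ⟨y, hy⟩ : (Ω.image g ∩ Ω).Nonempty := by
      rw [← Finset.card_pos]
      have h1 := Finset.card_union_add_card_inter (Ω.image g) Ω
      have h2 := Finset.card_le_univ (Ω.image g ∪ Ω)
      rw [Finset.card_image_of_injective _ g.injective] at h1
      omega
    rw [Finset.mem_inter, Finset.mem_image] at hy
    obtain ⟨⟨z, hz, rfl⟩, hgz⟩ := hy
    rw [hΩ, mem_threeCycleClass] at *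
    exact hgz.trans ((hz.symm.trans hx).map hg)
  have hinv : ∀ g ∈ H, ∀ x, g x ∈ Ω ↔ x ∈ Ω := fun g hg x =>
    ⟨fun h => by simpa using hmap _ (H.inv_mem hg) _ h, hmap g hg x⟩
  refine ⟨Ω, ?_, hinv, fun a ha b hb c hc hab hac hbc => ?_⟩
  · by_contra! h
    have h1 := choose_card_le_index hinv
    rw [← Nat.choose_symm (Finset.card_le_univ _)] at h1
    rw [Finset.card_compl] at h
    -- Binomial coefficients increase up to the middle, and the complement of `Ω` has at most half
    -- of the points.
    have h2 : (Fintype.card α).choose k ≤ (Fintype.card α).choose (Fintype.card α - Ω.card) := by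
      have hle : Fintype.card α - Ω.card ≤ Fintype.card α / 2 := by omega
      clear h1 hk
      generalize Fintype.card α - Ω.card = d at h hle
      induction d, h using Nat.le_induction with
      | base => exact le_rfl
      | succ d hd ih =>
        exact (ih (by omega)).trans (Nat.choose_le_succ_of_lt_half_left (by omega))
    omega
  · rw [hΩ, mem_threeCycleClass] at ha hb hc
    exact threeCycle_mem_of_rel hab hac hbc (ha.symm.trans hb) (ha.symm.trans hc)

end Support

/-! ### Divisibility of products and of orbit sums. -/

/-- Fewer than `a` of the factors `p` can come from `y`. This bounds from below the orbits of a
power of a cyclic shift. -/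
theorem Prime.pow_dvd_of_pow_add_dvd_mul {p x y : ℤ} (hp : Prime p) {a f : ℕ}
    (h : p ^ (a + f) ∣ x * y) (hy : ¬ p ^ a ∣ y) : p ^ f ∣ x := by
  induction a generalizing y with
  | zero => simp at hy
  | succ a ih =>
    by_cases hpy : p ∣ y
    · obtain ⟨z, rfl⟩ := hpy
      refine ih (y := z) ?_ fun hz => hy ?_
      · rw [show a + 1 + f = a + f + 1 by ring, pow_succ', mul_left_comm] at h
        exact (mul_dvd_mul_iff_left hp.ne_zero).1 h
      · rw [pow_succ']
        exact mul_dvd_mul_left p hz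
    · exact (pow_dvd_pow p (by omega)).trans (hp.pow_dvd_of_dvd_mul_right _ hpy h)

/-- A function that is invariant under a permutation and vanishes on the orbits whose length is
not divisible by `q` has a sum divisible by `q`. -/
theorem dvd_sum_of_minimalPeriod {G : Type*} [Fintype G] (σ : Equiv.Perm G) (F : G → ℤ) (q : ℕ)
    (hF : ∀ g, F (σ g) = F g)
    (h0 : ∀ g, ¬ q ∣ Function.minimalPeriod σ g → F g = 0) : (q : ℤ) ∣ ∑ g, F g := by
  classical
  let S := MulAction.orbitRel (Subgroup.zpowers σ) G
  have hFz : ∀ τ ∈ Subgroup.zpowers σ, ∀ g, F (τ g) = F g := by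
    intro τ hτ
    rw [Subgroup.zpowers_eq_closure] at hτ
    induction hτ using Subgroup.closure_induction with
    | mem τ h => rw [Set.mem_singleton_iff.1 h]; exact hF
    | one => exact fun _ => rfl
    | mul τ τ' _ _ h h' => intro g; rw [Equiv.Perm.mul_apply, h, h']
    | inv τ _ h => intro g; rw [← h]; simp
  rw [← Finset.sum_fiberwise Finset.univ (fun g => Quotient.mk S g) F]
  refine Finset.dvd_sum fun ω _ => ?_
  obtain ⟨g₀, rfl⟩ := Quotient.exists_rep ω
  have hfib : ∀ g, g ∈ Finset.univ.filter (fun g => Quotient.mk S g = Quotient.mk S g₀) ↔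
      g ∈ MulAction.orbit (Subgroup.zpowers σ) g₀ := by
    intro g
    rw [Finset.mem_filter, Quotient.eq]
    simp only [Finset.mem_univ, true_and]
    exact MulAction.orbitRel_apply
  rw [Finset.sum_congr rfl (g := fun _ => F g₀), Finset.sum_const, nsmul_eq_mul]
  · have hcard : (Finset.univ.filter
        (fun g => Quotient.mk S g = Quotient.mk S g₀)).card = Function.minimalPeriod σ g₀ := by
      have := MulAction.minimalPeriod_eq_card (a := σ) (b := g₀)
      rw [show (fun x => σ • x) = (σ : G → G) from rfl] at this
      rw [this, ← Set.toFinset_card]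
      congr 1
      ext g
      rw [hfib, Set.mem_toFinset]
    rw [hcard]
    by_cases hq : q ∣ Function.minimalPeriod σ g₀
    · exact Dvd.dvd.mul_right (by exact_mod_cast hq) _
    · rw [h0 _ hq, mul_zero]
      exact dvd_zero _
  · intro g hg
    obtain ⟨τ, rfl⟩ := (hfib g).1 hg
    exact hFz _ τ.2 _

/-! ### Circuit automorphisms and gate stabilizers. -/

namespace ModCircuit

variable {m n : ℕ} {C : ModCircuit m n} {π π' : Equiv.Perm (Fin n)} {σ σ' : Equiv.Perm C.Gate}

theorem extends_one (C : ModCircuit m n) : C.Extends 1 1 :=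
  ⟨fun g => by cases h : C.label g <;> simp [h], fun _ _ => rfl⟩

theorem Extends.mul (h : C.Extends π σ) (h' : C.Extends π' σ') : C.Extends (π * π') (σ * σ') :=
  ⟨fun g => by
    rw [Equiv.Perm.mul_apply, h.1, h'.1]
    cases C.label g <;> simp, fun g g' => by
    rw [Equiv.Perm.mul_apply, Equiv.Perm.mul_apply, h.2, h'.2]⟩

theorem Extends.inv (h : C.Extends π σ) : C.Extends π⁻¹ σ⁻¹ :=
  ⟨fun g => by
    have := h.1 (σ⁻¹ g)
    rw [show σ (σ⁻¹ g) = g from σ.apply_symm_apply g] at this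
    rw [this]
    cases C.label (σ⁻¹ g) <;> simp, fun g g' => by
    have := h.2 (σ⁻¹ g) (σ⁻¹ g')
    rwa [show σ (σ⁻¹ g) = g from σ.apply_symm_apply g,
      show σ (σ⁻¹ g') = g' from σ.apply_symm_apply g', eq_comm] at this⟩

theorem Extends.pow (h : C.Extends π σ) (l : ℕ) : C.Extends (π ^ l) (σ ^ l) := by
  induction l with
  | zero => exact C.extends_one
  | succ l ih => rw [pow_succ, pow_succ]; exact ih.mul h

theorem Extends.apply_inl (h : C.Extends π σ) (i : Fin n) :
    σ (Sum.inl i) = Sum.inl (π i) := by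
  have := h.1 (Sum.inl i)
  rcases hσ : σ (Sum.inl i) with j | j <;> rw [hσ] at this <;> simp [label] at this
  rw [this]

theorem Extends.apply_inr (h : C.Extends π σ) (j : C.Inner) :
    ∃ j', σ (Sum.inr j) = Sum.inr j' ∧ C.accept j' = C.accept j := by
  have := h.1 (Sum.inr j)
  rcases hσ : σ (Sum.inr j) with j' | j' <;> rw [hσ] at this <;> simp [label] at this
  exact ⟨j', rfl, this⟩

theorem Extends.eval (h : C.Extends π σ) (x : Fin n → Bool) (g : C.Gate) :
    C.eval x (σ g) = C.eval (x ∘ π) g := by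
  induction g using C.wellFounded_isWire.induction with
  | _ g ih =>
  rcases g with i | j
  · rw [h.apply_inl, eval_inl, eval_inl, Function.comp_apply]
  · obtain ⟨j', hj', hacc⟩ := h.apply_inr j
    rw [hj', Bool.eq_iff_iff, eval_inr, eval_inr, hacc, ← Equiv.sum_comp σ]
    have : ∀ g, (C.wires (σ g) (Sum.inr j') : ZMod m) * ((C.eval x (σ g)).toNat : ZMod m) =
        (C.wires g (Sum.inr j) : ZMod m) * ((C.eval (x ∘ π) g).toNat : ZMod m) := by
      intro g
      rw [← hj', h.2]
      rcases Nat.eq_zero_or_pos (C.wires g (Sum.inr j)) with hw | hw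
      · rw [hw]; simp
      · rw [ih g hw]
    rw [Finset.sum_congr rfl fun g _ => this g]

/-- The permutations of the variables that extend to an automorphism fixing the gate `g`. -/
def gateStabilizer (C : ModCircuit m n) (g : C.Gate) : Subgroup (Equiv.Perm (Fin n)) where
  carrier := {π | ∃ σ : Equiv.Perm C.Gate, C.Extends π σ ∧ σ g = g}
  one_mem' := ⟨1, C.extends_one, rfl⟩
  mul_mem' := by
    rintro π π' ⟨σ, h, hg⟩ ⟨σ', h', hg'⟩
    exact ⟨σ * σ', h.mul h', by rw [Equiv.Perm.mul_apply, hg', hg]⟩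
  inv_mem' := by
    rintro π ⟨σ, h, hg⟩
    exact ⟨σ⁻¹, h.inv, by rw [Equiv.Perm.inv_eq_iff_eq, hg]⟩

/-- Orbit-stabilizer without a group action: lifts of a permutation need not be unique, but after
choosing one for each, distinct cosets still send `g` to distinct gates. -/
theorem index_gateStabilizer_le (hC : C.IsSymmetric ⊤) (g : C.Gate) :
    (C.gateStabilizer g).index ≤ Fintype.card C.Gate := by
  choose σ hσ using fun π => hC π (Subgroup.mem_top π)
  rw [Subgroup.index, ← Nat.card_eq_fintype_card]
  refine Nat.card_le_card_of_injective
    (fun q : Equiv.Perm (Fin n) ⧸ C.gateStabilizer g => σ q.out g) fun q q' h => ?_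
  rw [← q.out_eq', ← q'.out_eq', QuotientGroup.eq]
  refine ⟨(σ q.out)⁻¹ * σ q'.out, (hσ _).inv.mul (hσ _), ?_⟩
  rw [Equiv.Perm.mul_apply, Equiv.Perm.inv_eq_iff_eq]
  exact h.symm

/-! ### Invisibility of a flipped block. -/

open Equiv in
/-- Flipping a block `ι (ℤ/M)` of equal bits does not change the value of a gate that is
stabilized by the alternating group of the block, if every gate stabilizer contains the
alternating group of an invariant set that misses few points compared to the prime powers
dividing `M`. -/
theorem eval_eq_of_alternatingGroup_le (hm : m ≠ 0) {k M : ℕ} [NeZero M] (ι : ZMod M ↪ Fin n)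
    (hM : ∀ p ∈ m.primeFactors, ∃ f, k ≤ p ^ f ∧ 2 * p ^ (m.factorization p + f) ∣ M)
    (hm1 : m.primeFactors.Nonempty)
    (hC : ∀ g : C.Gate, ∃ Ω : Finset (Fin n), (Ωᶜ).card < k ∧
      (∀ π ∈ C.gateStabilizer g, ∀ i, π i ∈ Ω ↔ i ∈ Ω) ∧
      ∀ a ∈ Ω, ∀ b ∈ Ω, ∀ c ∈ Ω, a ≠ b → a ≠ c → b ≠ c →
        threeCycle a b c ∈ C.gateStabilizer g)
    {x x' : Fin n → Bool} (hx : ∀ i, i ∉ Set.range ι → x i = x' i)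
    (hxι : ∀ a b, x (ι a) = x (ι b)) (hxι' : ∀ a b, x' (ι a) = x' (ι b)) (g : C.Gate)
    (hg : alternatingGroup (ZMod M) ≤ (C.gateStabilizer g).comap (Perm.viaEmbeddingHom ι)) :
    C.eval x g = C.eval x' g := by
  -- Such a translation is a square, hence even; this is why `M` carries the factor `2`.
  have htrans : ∀ v : ZMod M, Equiv.addRight (v + v) ∈ alternatingGroup (ZMod M) := by
    intro v
    have : Equiv.addRight (v + v) = Equiv.addRight v * Equiv.addRight v := by
      ext y; simp [add_assoc]
    rw [Perm.mem_alternatingGroup, this, map_mul, Int.units_mul_self]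
  have hpow : ∀ (u : ZMod M) (l : ℕ) (b : ZMod M),
      (((Equiv.addRight u).viaEmbedding ι) ^ l) (ι b) = ι (b + l * u) := by
    intro u l b
    induction l with
    | zero => simp
    | succ l ih =>
      rw [pow_succ', Perm.mul_apply, ih, Perm.viaEmbedding_apply]
      simp only [Equiv.coe_addRight]
      congr 1
      push_cast
      ring
  have hinvar : ∀ (u : ZMod M) (y : Fin n → Bool), (∀ a b, y (ι a) = y (ι b)) →
      y ∘ ((Equiv.addRight u).viaEmbedding ι) = y := by
    intro u y hy
    ext i
    by_cases hi : i ∈ Set.range ι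
    · obtain ⟨b, rfl⟩ := hi
      rw [Function.comp_apply, Perm.viaEmbedding_apply]
      exact hy _ _
    · rw [Function.comp_apply, Perm.viaEmbedding_apply_of_notMem _ _ _ hi]
  induction g using C.wellFounded_isWire.induction with
  | _ g ih =>
  rcases g with i | j
  · rw [eval_inl, eval_inl]
    refine hx i ?_
    -- The gate of a block variable is not stabilized: translation by `2` is even and, as `M ≥ 4`,
    -- has no fixed point.
    rintro ⟨b, rfl⟩
    obtain ⟨p, hp⟩ := hm1
    obtain ⟨f, -, hf⟩ := hM p hp
    have hM4 : 4 ≤ M := by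
      have hp2 := (Nat.prime_of_mem_primeFactors hp).two_le
      have h1 : 1 ≤ m.factorization p :=
        (Nat.prime_of_mem_primeFactors hp).factorization_pos_of_dvd hm
          (Nat.dvd_of_mem_primeFactors hp)
      have h2 : p ^ 1 ≤ p ^ (m.factorization p + f) :=
        Nat.pow_le_pow_right (by omega) (by omega)
      have h3 := Nat.le_of_dvd (NeZero.pos M) hf
      rw [pow_one] at h2
      omega
    obtain ⟨σ, hσ, hσb⟩ := hg (htrans 1)
    rw [hσ.apply_inl] at hσb
    have h1 := Sum.inl_injective hσb
    rw [Perm.viaEmbeddingHom_apply, Perm.viaEmbedding_apply] at h1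
    have h2 := ι.injective h1
    simp only [Equiv.coe_addRight, add_eq_left] at h2
    have h3 : ((2 : ℕ) : ZMod M) = 0 := by push_cast; rw [← h2]; norm_num
    rw [ZMod.natCast_eq_zero_iff] at h3
    have := Nat.le_of_dvd (by norm_num) h3
    omega
  · set F : C.Gate → ℤ := fun h => (C.wires h (Sum.inr j) : ℤ) *
      (((C.eval x h).toNat : ℤ) - ((C.eval x' h).toNat : ℤ)) with hF
    suffices hdvd : (m : ℤ) ∣ ∑ h, F h by
      rw [← ZMod.intCast_zmod_eq_zero_iff_dvd] at hdvd
      have : (∑ h : C.Gate, (C.wires h (Sum.inr j) : ZMod m) * ((C.eval x h).toNat : ZMod m)) =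
          ∑ h : C.Gate, (C.wires h (Sum.inr j) : ZMod m) * ((C.eval x' h).toNat : ZMod m) := by
        rw [← sub_eq_zero, ← Finset.sum_sub_distrib, ← hdvd]
        push_cast [hF]
        exact Finset.sum_congr rfl fun _ _ => by ring
      rw [Bool.eq_iff_iff, eval_inr, eval_inr, this]
    obtain ⟨N, hN⟩ : ∃ N, N = ∑ h, F h := ⟨_, rfl⟩
    rw [← hN, Int.natCast_dvd, Nat.dvd_iff_prime_pow_dvd_dvd]
    intro p t hp hpt
    rcases Nat.eq_zero_or_pos t with rfl | ht
    · simp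
    have hpm : p ∈ m.primeFactors :=
      Nat.mem_primeFactors.2 ⟨hp, (dvd_pow_self p ht.ne').trans hpt, hm⟩
    refine (pow_dvd_pow p ((hp.pow_dvd_iff_le_factorization hm).1 hpt)).trans ?_
    rw [← Int.natCast_dvd, hN]
    obtain ⟨f, hkf, c, hc⟩ := hM p hpm
    set a := m.factorization p
    have hc0 : c ≠ 0 := by
      rintro rfl
      exact NeZero.ne M (by simpa using hc)
    -- As `M = 2 * p ^ (a + f) * c`, translation by `2 * c` has order `p ^ (a + f)`.
    set u : ZMod M := (c : ZMod M) + c with hu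
    obtain ⟨σ, hσ, hσj⟩ := hg (htrans c)
    rw [Perm.viaEmbeddingHom_apply] at hσ
    refine dvd_sum_of_minimalPeriod σ F _ (fun h => ?_) fun h hl => ?_
    · simp only [hF]
      rw [hσ.eval, hσ.eval, hinvar _ _ hxι, hinvar _ _ hxι']
      congr 2
      conv_lhs => rw [← hσj]
      exact hσ.2 _ _
    · rcases Nat.eq_zero_or_pos (C.wires h (Sum.inr j)) with hw | hw
      · simp [hF, hw]
      suffices hh : C.eval x h = C.eval x' h by simp [hF, hh]
      refine ih h hw ?_
      set l := Function.minimalPeriod σ h with hldef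
      have hstab : ((Equiv.addRight u).viaEmbedding ι) ^ l ∈ C.gateStabilizer h := by
        refine ⟨σ ^ l, hσ.pow l, ?_⟩
        rw [Perm.coe_pow]
        exact Function.iterate_minimalPeriod
      obtain ⟨Ω, hΩk, hΩinv, hΩ⟩ := hC h
      -- A block point outside `Ω` would drag its orbit under the `l`-th power of the shift outside
      -- too. As `p ^ a ∤ l`, this orbit has at least `p ^ f ≥ k` points, more than `Ωᶜ` has.
      have hιΩ : ∀ b, ι b ∈ Ω := by
        intro b
        by_contra hb
        have horb : ∀ i : ℕ, ι (b + (l * i : ℕ) * u) ∈ Ωᶜ := by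
          intro i
          rw [← hpow, pow_mul, Finset.mem_compl,
            hΩinv _ (Subgroup.pow_mem _ hstab i)]
          exact hb
        have hinj : Set.InjOn (fun i : ℕ => ι (b + (l * i : ℕ) * u))
            (Finset.range (p ^ f) : Set ℕ) := by
          intro i hi i' hi' hii
          have h1 := add_left_cancel (ι.injective hii)
          have h2 : ((((i : ℤ) - i') * l * (2 * c) : ℤ) : ZMod M) = 0 := by
            push_cast
            rw [← sub_eq_zero] at h1
            rw [← h1, hu]
            push_cast
            ring
          rw [ZMod.intCast_zmod_eq_zero_iff_dvd, hc] at h2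
          have h3 : ((p : ℤ) ^ (a + f)) ∣ ((i : ℤ) - i') * l := by
            have h4 : (2 * c : ℤ) ≠ 0 := by positivity
            refine (mul_dvd_mul_iff_right h4).1 ?_
            refine Dvd.dvd.trans (dvd_of_eq ?_) h2
            push_cast
            ring
          have h5 := Prime.pow_dvd_of_pow_add_dvd_mul (Nat.prime_iff_prime_int.1 hp) h3
            (by exact_mod_cast hl)
          rw [Finset.coe_range, Set.mem_Iio] at hi hi'
          have h6 : ((i : ℤ) - i') = 0 := by
            refine Int.eq_zero_of_abs_lt_dvd h5 ?_
            have : (p : ℤ) ^ f = ((p ^ f : ℕ) : ℤ) := by push_cast; rfl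
            rw [this, abs_lt]
            omega
          omega
        have hle := Finset.card_le_card_of_injOn _ (fun i _ => horb i) hinj
        rw [Finset.card_range] at hle
        omega
      exact alternatingGroup_le_comap_viaEmbeddingHom ι fun a b c hab hac hbc =>
        hΩ _ (hιΩ a) _ (hιΩ b) _ (hιΩ c) (ι.injective.ne hab) (ι.injective.ne hac)
          (ι.injective.ne hbc)

end ModCircuit

/-! ### The lower bound. -/

namespace ModCircuit

open Equiv in
/-- A symmetric circuit with few gates does not compute the conjunction. -/
theorem not_computesAND_of_card_lt_choose {m n k L : ℕ} (hm : m ≠ 0)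
    (hm1 : m.primeFactors.Nonempty) (hk : k ≠ 0) {C : ModCircuit m n} (hC : C.IsSymmetric ⊤)
    (hL : Fintype.card C.Gate ≤ 2 ^ L) (hLn : 16 * L + 12 ≤ n)
    (hchoose : Fintype.card C.Gate < n.choose k)
    (hMn : 2 * m ^ 2 * k ^ m.primeFactors.card + k ≤ n) : ¬ C.ComputesAND := by
  intro hAND
  -- `p ^ Nat.clog p k` is a power of `p` between `k` and `p * k`, so `M` is at most a constant
  -- times `k ^ r`.
  set M := 2 * ∏ p ∈ m.primeFactors, p ^ (m.factorization p + Nat.clog p k) with hMdef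
  have hM0 : M ≠ 0 := by
    rw [hMdef]
    refine mul_ne_zero two_ne_zero (Finset.prod_ne_zero_iff.2 fun p hp => ?_)
    exact pow_ne_zero _ (Nat.prime_of_mem_primeFactors hp).ne_zero
  have : NeZero M := ⟨hM0⟩
  have hMle : M ≤ 2 * m ^ 2 * k ^ m.primeFactors.card := by
    have h1 : ∏ p ∈ m.primeFactors, p ^ m.factorization p = m :=
      Nat.prod_factorization_pow_eq_self hm
    have h2 : ∏ p ∈ m.primeFactors, p ^ Nat.clog p k ≤ m * k ^ m.primeFactors.card := by
      calc _ ≤ ∏ p ∈ m.primeFactors, p * k := Finset.prod_le_prod' fun p hp => by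
            have hp1 := (Nat.prime_of_mem_primeFactors hp).one_lt
            rcases Nat.eq_zero_or_pos (Nat.clog p k) with h | h
            · rw [h, pow_zero]
              exact Nat.mul_pos (by omega) (Nat.pos_of_ne_zero hk)
            · have h3 := (Nat.pow_lt_of_lt_clog (b := p) (x := k) (y := Nat.clog p k - 1)
                (by omega)).le
              calc p ^ Nat.clog p k = p * p ^ (Nat.clog p k - 1) := by
                    rw [← pow_succ']; congr 1; omega
                _ ≤ p * k := Nat.mul_le_mul_left _ h3
        _ = (∏ p ∈ m.primeFactors, p) * k ^ m.primeFactors.card := by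
            rw [Finset.prod_mul_distrib, Finset.prod_const]
        _ ≤ _ := Nat.mul_le_mul_right _
            (Nat.le_of_dvd (Nat.pos_of_ne_zero hm) (Nat.prod_primeFactors_dvd m))
    calc M = 2 * (m * ∏ p ∈ m.primeFactors, p ^ Nat.clog p k) := by
          rw [hMdef]
          simp only [pow_add, Finset.prod_mul_distrib]
          rw [h1]
      _ ≤ 2 * (m * (m * k ^ m.primeFactors.card)) := by gcongr
      _ = _ := by ring
  have hsupp : ∀ g : C.Gate, ∃ Ω : Finset (Fin n), (Ωᶜ).card < k ∧
      (∀ π ∈ C.gateStabilizer g, ∀ i, π i ∈ Ω ↔ i ∈ Ω) ∧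
      ∀ a ∈ Ω, ∀ b ∈ Ω, ∀ c ∈ Ω, a ≠ b → a ≠ c → b ≠ c →
        threeCycle a b c ∈ C.gateStabilizer g := fun g =>
    exists_invariant_of_index_lt_choose ((index_gateStabilizer_le hC g).trans hL)
      (by rwa [Fintype.card_fin])
      (by rw [Fintype.card_fin]; exact (index_gateStabilizer_le hC g).trans_lt hchoose)
  obtain ⟨Ω, hΩk, -, hΩ⟩ := hsupp C.root
  obtain ⟨ι₀⟩ : Nonempty (ZMod M ↪ Ω) := by
    refine Function.Embedding.nonempty_of_card_le ?_
    rw [ZMod.card, Fintype.card_coe]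
    rw [Finset.card_compl, Fintype.card_fin] at hΩk
    omega
  let ι : ZMod M ↪ Fin n := ι₀.trans (Function.Embedding.subtype _)
  have hιΩ : ∀ b, ι b ∈ Ω := fun b => (ι₀ b).2
  classical
  have key := eval_eq_of_alternatingGroup_le hm ι (k := k) (C := C) (fun p hp =>
    ⟨Nat.clog p k, Nat.le_pow_clog (Nat.prime_of_mem_primeFactors hp).one_lt k,
      Nat.mul_dvd_mul_left 2 (Finset.dvd_prod_of_mem
        (fun p => p ^ (m.factorization p + Nat.clog p k)) hp)⟩) hm1 hsupp
    (x := fun i => decide (i ∉ Set.range ι)) (x' := fun _ => true)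
    (fun i hi => decide_eq_true hi) (fun a b => by simp) (fun _ _ => rfl) C.root
    (alternatingGroup_le_comap_viaEmbeddingHom ι fun a b c hab hac hbc =>
        hΩ _ (hιΩ a) _ (hιΩ b) _ (hιΩ c) (ι.injective.ne hab) (ι.injective.ne hac)
          (ι.injective.ne hbc))
  have h1 := (hAND fun _ => true).2 fun _ => rfl
  rw [← key, hAND] at h1
  simpa using h1 (ι 0)

end ModCircuit

/-- `n.choose k ≥ ((n + 1 - k) / k) ^ k`, and the base is at least `√n` because `n + 1 - k ≥ n / 2 ≥
k * √n`. -/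
theorem pow_le_choose_sq {n k : ℕ} (hk : 4 * k ^ 2 ≤ n) (hk0 : k ≠ 0) :
    n ^ k ≤ n.choose k ^ 2 := by
  have hkn : 2 * k ≤ n := by nlinarith [Nat.pos_of_ne_zero hk0]
  have h1 : (n + 1 - k) ^ k ≤ k ^ k * n.choose k := by
    have h := Nat.pow_le_choose (α := ℚ) k n
    rw [div_le_iff₀ (by positivity)] at h
    have h' : (n + 1 - k) ^ k ≤ n.choose k * k.factorial := by exact_mod_cast h
    rw [mul_comm] at h'
    exact h'.trans (Nat.mul_le_mul_right _ (Nat.factorial_le_pow k))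
  have h2 : n * k ^ 2 ≤ (n + 1 - k) ^ 2 := by
    obtain ⟨d, rfl⟩ : ∃ d, n = 2 * k + d := ⟨n - 2 * k, by omega⟩
    rw [show 2 * k + d + 1 - k = k + d + 1 by omega]
    nlinarith
  have h3 : n ^ k * (k ^ k) ^ 2 ≤ n.choose k ^ 2 * (k ^ k) ^ 2 :=
    calc n ^ k * (k ^ k) ^ 2 = (n * k ^ 2) ^ k := by rw [mul_pow]; ring
      _ ≤ ((n + 1 - k) ^ 2) ^ k := Nat.pow_le_pow_left h2 k
      _ = ((n + 1 - k) ^ k) ^ 2 := by ring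
      _ ≤ (k ^ k * n.choose k) ^ 2 := Nat.pow_le_pow_left h1 2
      _ = _ := by ring
  exact Nat.le_of_mul_le_mul_right h3 (by positivity)

/-- The lower bound on the size of symmetric circuits for the conjunction. -/
theorem ModCircuit.exists_two_rpow_le_size {m r : ℕ} (hm : m ≠ 0) (hr : 2 ≤ r)
    (hmr : m.primeFactors.card = r) :
    ∃ c : ℝ, 0 < c ∧ ∃ N : ℕ, ∀ n : ℕ, N ≤ n → ∀ C : ModCircuit m n,
      C.IsSymmetric ⊤ → C.ComputesAND →
        (2 : ℝ) ^ (c * ((n : ℝ) ^ (1 / (r : ℝ)) * Real.log n)) ≤ (C.size : ℝ) := by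
  set δ : ℝ := (1 / (4 * (m : ℝ) ^ 2)) ^ (1 / (r : ℝ)) with hδ
  have hm0 : (0 : ℝ) < m := by exact_mod_cast Nat.pos_of_ne_zero hm
  have hm1 : (1 : ℝ) ≤ m := by exact_mod_cast Nat.one_le_iff_ne_zero.2 hm
  have hr0 : (0 : ℝ) < r := by exact_mod_cast (by omega : 0 < r)
  have hδ0 : 0 < δ := by positivity
  obtain ⟨N₀, hN₀⟩ : ∃ N₀ : ℕ, ∀ n ≥ N₀, Real.log n ≤ 1 / 4 * (n : ℝ) ^ (1 / 2 : ℝ) := by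
    have h := (isLittleO_log_rpow_atTop (show (0 : ℝ) < 1 / 2 by norm_num)).bound
      (show (0 : ℝ) < 1 / 4 by norm_num)
    have h' := tendsto_natCast_atTop_atTop.eventually h
    rw [Filter.eventually_atTop] at h'
    obtain ⟨N₀, hN₀⟩ := h'
    refine ⟨N₀, fun n hn => (le_abs_self _).trans ?_⟩
    have := hN₀ n hn
    rwa [Real.norm_eq_abs, Real.norm_of_nonneg (by positivity)] at this
  -- `4 * m ^ 2 ≤ n` gives `k ≥ 1` below; `N₀` and `100` secure `16 * L + 12 ≤ n`.
  refine ⟨δ / 8, by positivity, max N₀ (max 100 (4 * m ^ 2)), fun n hn C hC hAND => ?_⟩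
  by_contra! hlt
  have hnN : N₀ ≤ n := (le_max_left _ _).trans hn
  have hn100 : 100 ≤ n := (le_max_left _ _).trans ((le_max_right _ _).trans hn)
  have hnm : 4 * m ^ 2 ≤ n := (le_max_right _ _).trans ((le_max_right _ _).trans hn)
  have hn0 : (0 : ℝ) < n := by exact_mod_cast (by omega : 0 < n)
  have hlog0 : 0 ≤ Real.log n := Real.log_natCast_nonneg n
  set y : ℝ := (n / (4 * (m : ℝ) ^ 2)) ^ (1 / (r : ℝ)) with hy
  have hyδ : y = δ * (n : ℝ) ^ (1 / (r : ℝ)) := by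
    rw [hy, hδ, ← Real.mul_rpow (by positivity) hn0.le]
    congr 1
    ring
  have hy1 : 1 ≤ y := by
    refine Real.one_le_rpow ?_ (by positivity)
    rw [le_div_iff₀ (by positivity), one_mul]
    exact_mod_cast hnm
  have hyr : y ^ r = n / (4 * (m : ℝ) ^ 2) := by
    rw [hy, ← Real.rpow_natCast, ← Real.rpow_mul (by positivity), one_div_mul_cancel hr0.ne',
      Real.rpow_one]
  -- `y` solves `4 * m ^ 2 * y ^ r = n`, so the block fits; as `y ≥ 1`, rounding down loses at most
  -- a factor `2`.
  set k := ⌊y⌋₊ with hk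
  have hky : (k : ℝ) ≤ y := Nat.floor_le (by linarith)
  have hk1 : 1 ≤ k := Nat.le_floor (by simpa using hy1)
  have hk1' : (1 : ℝ) ≤ k := by exact_mod_cast hk1
  have hyk : y ≤ 2 * k := by
    have := Nat.lt_floor_add_one y
    rw [← hk] at this
    linarith
  have hkr : 4 * m ^ 2 * k ^ r ≤ n := by
    have : (k : ℝ) ^ r ≤ n / (4 * (m : ℝ) ^ 2) := hyr ▸ pow_le_pow_left₀ (by positivity) hky r
    rw [le_div_iff₀ (by positivity)] at this
    rw [mul_comm]
    exact_mod_cast this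
  have hk2r : k ^ 2 ≤ k ^ r := Nat.pow_le_pow_right hk1 hr
  have hm2 : 1 ≤ m ^ 2 := Nat.one_le_pow _ _ (Nat.pos_of_ne_zero hm)
  have hk2 : 4 * k ^ 2 ≤ n :=
    calc 4 * k ^ 2 = 4 * 1 * k ^ 2 := by ring
      _ ≤ 4 * m ^ 2 * k ^ r := by gcongr
      _ ≤ n := hkr
  have hexp : (δ / 8) * ((n : ℝ) ^ (1 / (r : ℝ)) * Real.log n) ≤ k / 4 * Real.log n := by
    calc _ = y / 8 * Real.log n := by rw [hyδ]; ring
      _ ≤ k / 4 * Real.log n :=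
        mul_le_mul_of_nonneg_right (by linarith) hlog0
  have hgate : Fintype.card C.Gate ≤ C.size := Nat.le_add_right _ _
  have hsize : (C.size : ℝ) < (2 : ℝ) ^ (k / 4 * Real.log n) :=
    hlt.trans_le (Real.rpow_le_rpow_of_exponent_le (by norm_num) hexp)
  refine not_computesAND_of_card_lt_choose (k := k) (L := ⌈k / 4 * Real.log n⌉₊) hm
    (Finset.card_pos.1 (by omega)) (by omega) hC ?_ ?_ ?_ ?_ hAND
  · refine hgate.trans ?_
    have : (C.size : ℝ) ≤ (2 : ℝ) ^ ⌈k / 4 * Real.log n⌉₊ := by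
      rw [← Real.rpow_natCast]
      exact hsize.le.trans (Real.rpow_le_rpow_of_exponent_le (by norm_num) (Nat.le_ceil _))
    exact_mod_cast this
  · have h1 := Nat.ceil_lt_add_one (show 0 ≤ k / 4 * Real.log n by positivity)
    have h2 : (k : ℝ) ≤ (n : ℝ) ^ (1 / 2 : ℝ) / 2 := by
      rw [← Real.sqrt_eq_rpow, le_div_iff₀ (by norm_num)]
      refine Real.le_sqrt_of_sq_le ?_
      have : (4 * k ^ 2 : ℝ) ≤ n := by exact_mod_cast hk2
      linarith
    have h3 : (n : ℝ) ^ (1 / 2 : ℝ) * (n : ℝ) ^ (1 / 2 : ℝ) = n := by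
      rw [← Real.sqrt_eq_rpow, Real.mul_self_sqrt hn0.le]
    have h4 : (k : ℝ) * Real.log n ≤ n / 8 := by
      calc (k : ℝ) * Real.log n
          ≤ ((n : ℝ) ^ (1 / 2 : ℝ) / 2) * (1 / 4 * (n : ℝ) ^ (1 / 2 : ℝ)) := by
            gcongr
            exact hN₀ n hnN
        _ = n / 8 := by linear_combination h3 / 8
    have h5 : (100 : ℝ) ≤ n := by exact_mod_cast hn100
    have : (16 * (⌈k / 4 * Real.log n⌉₊ : ℝ) + 12) ≤ n := by linarith
    exact_mod_cast this
  · have h1 : (C.size : ℝ) ^ 4 < (n : ℝ) ^ k := by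
      have h2 : (2 : ℝ) ^ (k / 4 * Real.log n) ≤ Real.exp (k / 4 * Real.log n) := by
        rw [← Real.exp_one_rpow (k / 4 * Real.log n)]
        refine Real.rpow_le_rpow (by norm_num) ?_ (by positivity)
        linarith [Real.add_one_le_exp (1 : ℝ)]
      calc (C.size : ℝ) ^ 4 < Real.exp (k / 4 * Real.log n) ^ 4 :=
            pow_lt_pow_left₀ (hsize.trans_le h2) (by positivity) (by norm_num)
        _ = Real.exp (k * Real.log n) := by rw [← Real.exp_nat_mul]; congr 1; push_cast; ring
        _ = (n : ℝ) ^ k := by rw [mul_comm, ← Real.rpow_def_of_pos hn0, Real.rpow_natCast]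
    have h2 : C.size ^ 4 < n ^ k := by exact_mod_cast h1
    have h3 := h2.trans_le (pow_le_choose_sq hk2 (by omega))
    have h4 : C.size ^ 2 ≤ C.size ^ 4 := by
      rcases Nat.eq_zero_or_pos C.size with h | h
      · simp [h]
      · exact Nat.pow_le_pow_right h (by norm_num)
    exact hgate.trans_lt (lt_of_pow_lt_pow_left₀ 2 (Nat.zero_le _) (h4.trans_lt h3))
  · rw [hmr]
    have h1 : 2 * k ≤ n := by nlinarith
    nlinarith

/-! ### Binomial sums modulo a prime. -/

/-- By Frobenius, `(X + 1) ^ (p ^ e) = X ^ (p ^ e) + 1`, and multiplying by it leaves the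
coefficients below degree `p ^ e` unchanged. -/
theorem cast_choose_add_prime_pow {p : ℕ} [Fact p.Prime] {e k : ℕ} (z : ℕ) (hk : k < p ^ e) :
    ((z + p ^ e).choose k : ZMod p) = (z.choose k : ZMod p) := by
  open Polynomial in
  have h : (X + 1 : (ZMod p)[X]) ^ (z + p ^ e) = (X + 1) ^ z * X ^ (p ^ e) + (X + 1) ^ z := by
    rw [pow_add, add_pow_char_pow, one_pow, mul_add, mul_one]
  have h2 := congrArg (fun P => Polynomial.coeff P k) h
  simpa [Polynomial.coeff_X_add_one_pow, Polynomial.coeff_mul_X_pow', hk.not_ge] using h2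

/-- Both sides are periodic in `z` with period `p ^ e`, and for `z < p ^ e` the sum is the full
expansion of `(1 - 1) ^ z`. -/
theorem sum_range_neg_one_pow_mul_choose {p : ℕ} [hp : Fact p.Prime] (e z : ℕ) :
    ∑ k ∈ Finset.range (p ^ e), (-1 : ZMod p) ^ k * (z.choose k : ZMod p) =
      if p ^ e ∣ z then 1 else 0 := by
  have hpos : 0 < p ^ e := Nat.pow_pos hp.out.pos
  induction z using Nat.strong_induction_on with
  | _ z ih =>
  rcases lt_or_ge z (p ^ e) with hz | hz
  · have h1 : ∑ k ∈ Finset.range (p ^ e), (-1 : ZMod p) ^ k * (z.choose k : ZMod p) =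
        ∑ k ∈ Finset.range (z + 1), (-1 : ZMod p) ^ k * (z.choose k : ZMod p) := by
      symm
      refine Finset.sum_subset (Finset.range_subset_range.2 hz) fun k _ hk => ?_
      rw [Finset.mem_range, not_lt] at hk
      rw [Nat.choose_eq_zero_of_lt hk, Nat.cast_zero, mul_zero]
    have h2 := congrArg (Int.cast : ℤ → ZMod p) (Int.alternating_sum_range_choose (n := z))
    push_cast at h2
    rw [h1, h2]
    congr 1
    rw [eq_iff_iff]
    exact ⟨fun h => h ▸ dvd_zero _, fun h => Nat.eq_zero_of_dvd_of_lt h hz⟩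
  · obtain ⟨y, rfl⟩ := Nat.exists_eq_add_of_le' hz
    have : p ^ e ∣ y + p ^ e ↔ p ^ e ∣ y := by simp
    rw [if_congr this rfl rfl, ← ih y (by omega)]
    refine Finset.sum_congr rfl fun k hk => ?_
    rw [cast_choose_add_prime_pow y (Finset.mem_range.1 hk)]

theorem sum_powerset_filter_card_lt {α R : Type*} [AddCommMonoid R] (Z : Finset α) (D : ℕ)
    (φ : ℕ → R) :
    ∑ S ∈ Z.powerset with S.card < D, φ S.card = ∑ k ∈ Finset.range D, Z.card.choose k • φ k := by
  rw [Finset.sum_filter, Finset.sum_powerset_apply_card (fun k => if k < D then φ k else 0)]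
  have h1 : ∑ k ∈ Finset.range (Z.card + 1), Z.card.choose k • (if k < D then φ k else 0) =
      ∑ k ∈ Finset.range (Z.card + 1 + D), Z.card.choose k • (if k < D then φ k else 0) := by
    refine Finset.sum_subset (Finset.range_subset_range.2 (by omega)) fun k _ hk => ?_
    rw [Finset.mem_range, not_lt] at hk
    rw [Nat.choose_eq_zero_of_lt hk, zero_smul]
  have h2 : ∑ k ∈ Finset.range D, Z.card.choose k • (if k < D then φ k else 0) =
      ∑ k ∈ Finset.range (Z.card + 1 + D), Z.card.choose k • (if k < D then φ k else 0) := by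
    refine Finset.sum_subset (Finset.range_subset_range.2 (by omega)) fun k _ hk => ?_
    rw [Finset.mem_range] at hk
    rw [if_neg hk, smul_zero]
  rw [h1, ← h2]
  exact Finset.sum_congr rfl fun k hk => by rw [if_pos (Finset.mem_range.1 hk)]

/-! ### Linear forms with prescribed support. -/

section PartialForms

variable {n q : ℕ}

/-- The domain of a partially defined coefficient vector. -/
def formSupport (w : Fin n → Option (Fin q)) : Finset (Fin n) :=
  Finset.univ.filter fun i => (w i).isSome

/-- The coefficient of `x_i`. -/
def formCoeff (w : Fin n → Option (Fin q)) (i : Fin n) : ℕ := (w i).elim 0 Fin.val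

/-- The value modulo `q` of the linear form with coefficients `w`. -/
def formValue (w : Fin n → Option (Fin q)) (x : Fin n → Bool) : ZMod q :=
  ∑ i, (formCoeff w i : ZMod q) * ((x i).toNat : ZMod q)

theorem card_filter_formSupport_eq (S : Finset (Fin n)) :
    (Finset.univ.filter fun w : Fin n → Option (Fin q) => formSupport w = S).card =
      q ^ S.card := by
  classical
  have : (Finset.univ.filter fun w : Fin n → Option (Fin q) => formSupport w = S) =
      Fintype.piFinset fun i => if i ∈ S then Finset.univ.image some else {none} := by
    ext w
    rw [Finset.mem_filter, Fintype.mem_piFinset, Finset.ext_iff]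
    simp only [Finset.mem_univ, true_and, formSupport, Finset.mem_filter]
    refine forall_congr' fun i => ?_
    by_cases hi : i ∈ S
    · simp only [hi, iff_true, if_true, Finset.mem_image, Finset.mem_univ, true_and,
        Option.isSome_iff_exists]
      exact exists_congr fun a => eq_comm
    · simp [hi]
  rw [this, Fintype.card_piFinset]
  have h2 : ∀ i, (if i ∈ S then Finset.univ.image some else ({none} : Finset (Option (Fin q)))).card =
      if i ∈ S then q else 1 := by
    intro i
    split_ifs
    · rw [Finset.card_image_of_injective _ (Option.some_injective _), Finset.card_univ,
        Fintype.card_fin]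
    · rfl
  rw [Finset.prod_congr rfl fun i _ => h2 i, Finset.prod_ite_mem, Finset.univ_inter,
    Finset.prod_const]

/-- If `x` vanishes on `S`, all `q ^ S.card` forms have value `0`. Otherwise `x i = true` for some
`i ∈ S`, and adding `1` to the coefficient of `i` matches the forms of value `0` with those of value
`1`. Coefficients that are present but zero make this shift preserve the support. -/
theorem sum_formSupport_eq {R : Type*} [CommRing R] (hq : 1 < q) (x : Fin n → Bool)
    (S : Finset (Fin n)) :
    ∑ w : Fin n → Option (Fin q) with formSupport w = S,
        ((if formValue w x = 0 then 1 else 0) - (if formValue w x = 1 then 1 else 0) : R) =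
      if S ⊆ Finset.univ.filter (fun i => x i = false) then (q : R) ^ S.card else 0 := by
  have : Fact (1 < q) := ⟨hq⟩
  have : NeZero q := ⟨by omega⟩
  split_ifs with hS
  · rw [Finset.sum_congr rfl (g := fun _ => (1 : R)), Finset.sum_const,
      card_filter_formSupport_eq, nsmul_eq_mul, mul_one, Nat.cast_pow]
    intro w hw
    rw [Finset.mem_filter] at hw
    have : formValue w x = 0 := by
      refine Finset.sum_eq_zero fun i _ => ?_
      by_cases hi : i ∈ S
      · have := hS hi
        rw [Finset.mem_filter] at this
        rw [this.2]; simp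
      · rw [← hw.2, formSupport, Finset.mem_filter] at hi
        have : w i = none := by simpa using hi
        rw [formCoeff, this]; simp
    rw [this, if_pos rfl, if_neg zero_ne_one, sub_zero]
  · obtain ⟨i, hiS, hi⟩ := Finset.not_subset.1 hS
    have hxi : x i = true := by simpa using hi
    rw [Finset.sum_sub_distrib, sub_eq_zero]
    let e : Equiv.Perm (Fin n → Option (Fin q)) := Equiv.piCongrRight fun j =>
      if j = i then Equiv.optionCongr (Equiv.addRight 1) else Equiv.refl _
    have hei : ∀ w, e w i = (w i).map (· + 1) := by
      intro w
      change (if i = i then Equiv.optionCongr (Equiv.addRight 1) else Equiv.refl _) (w i) = _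
      rw [if_pos rfl]; rfl
    have hej : ∀ w j, j ≠ i → e w j = w j := by
      intro w j hj
      change (if j = i then Equiv.optionCongr (Equiv.addRight 1) else Equiv.refl _) (w j) = _
      rw [if_neg hj]; rfl
    have hsupp : ∀ w, formSupport (e w) = formSupport w := by
      intro w
      refine Finset.filter_congr fun j _ => ?_
      by_cases hj : j = i
      · subst hj; rw [hei]; simp
      · rw [hej w j hj]
    refine Finset.sum_equiv e (fun w => by simp [hsupp]) fun w hw => ?_
    have hwi : (w i).isSome := by
      rw [Finset.mem_filter] at hw
      have := hw.2 ▸ hiS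
      rw [formSupport, Finset.mem_filter] at this
      exact this.2
    have hval : formValue (e w) x = formValue w x + 1 := by
      rw [← sub_eq_iff_eq_add', formValue, formValue, ← Finset.sum_sub_distrib,
        Finset.sum_eq_single i]
      · obtain ⟨a, ha⟩ := Option.isSome_iff_exists.1 hwi
        rw [hxi, formCoeff, formCoeff, hei, ha]
        simp [Fin.val_add]
      · intro j _ hj
        rw [formCoeff, formCoeff, hej w j hj, sub_self]
      · simp
    rw [hval]
    simp

/-- A signed count of linear forms modulo `q` detects, modulo `p`, whether the number of zeros
of `x` is divisible by `p ^ e`. -/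
theorem sum_formSupport_card_lt {p : ℕ} [Fact p.Prime] (hq : 1 < q) {c : ZMod p}
    (hc : c * q = 1) (e : ℕ) (x : Fin n → Bool) :
    ∑ w : Fin n → Option (Fin q) with (formSupport w).card < p ^ e, (-c) ^ (formSupport w).card *
        ((if formValue w x = 0 then 1 else 0) - (if formValue w x = 1 then 1 else 0) : ZMod p) =
      if p ^ e ∣ (Finset.univ.filter fun i => x i = false).card then 1 else 0 := by
  set Z := Finset.univ.filter fun i => x i = false with hZ
  rw [← Finset.sum_fiberwise_of_maps_to (g := formSupport)
    (t := Finset.univ.filter fun S : Finset (Fin n) => S.card < p ^ e) (by simp)]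
  have h1 : ∀ S ∈ Finset.univ.filter (fun S : Finset (Fin n) => S.card < p ^ e),
      ∑ w ∈ (Finset.univ.filter fun w : Fin n → Option (Fin q) =>
          (formSupport w).card < p ^ e) with formSupport w = S, (-c) ^ (formSupport w).card *
        ((if formValue w x = 0 then 1 else 0) - (if formValue w x = 1 then 1 else 0) : ZMod p) =
      if S ⊆ Z then (-1) ^ S.card else 0 := by
    intro S hS
    rw [Finset.mem_filter] at hS
    rw [Finset.filter_filter]
    have h2 : (Finset.univ.filter fun w : Fin n → Option (Fin q) =>
        (formSupport w).card < p ^ e ∧ formSupport w = S) =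
        Finset.univ.filter fun w => formSupport w = S :=
      Finset.filter_congr fun w _ => ⟨fun h => h.2, fun h => ⟨h ▸ hS.2, h⟩⟩
    rw [h2, Finset.sum_congr rfl fun w hw => by rw [(Finset.mem_filter.1 hw).2],
      ← Finset.mul_sum, sum_formSupport_eq hq x S]
    split_ifs
    · rw [← mul_pow, neg_mul, hc]
    · rw [mul_zero]
  rw [Finset.sum_congr rfl h1, ← Finset.sum_filter, Finset.filter_filter]
  have h3 : (Finset.univ.filter fun S : Finset (Fin n) => S.card < p ^ e ∧ S ⊆ Z) =
      Z.powerset.filter fun S => S.card < p ^ e := by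
    ext S; simp [and_comm]
  rw [h3, sum_powerset_filter_card_lt Z (p ^ e) fun k => (-1 : ZMod p) ^ k,
    ← sum_range_neg_one_pow_mul_choose]
  exact Finset.sum_congr rfl fun k _ => by rw [nsmul_eq_mul, mul_comm]

theorem card_filter_formSupport_card_lt_le {m D : ℕ} (hqm : q ≤ m) (hm : 2 ≤ m) (hn : 1 ≤ n) :
    (Finset.univ.filter fun w : Fin n → Option (Fin q) => (formSupport w).card < D).card ≤
      (n * m) ^ D := by
  rw [Finset.card_eq_sum_card_fiberwise (f := formSupport)
    (t := Finset.univ.powerset.filter fun S : Finset (Fin n) => S.card < D) (by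
      intro w hw; simpa using hw)]
  calc _ ≤ ∑ S ∈ Finset.univ.powerset.filter fun S : Finset (Fin n) => S.card < D,
        q ^ S.card := by
        refine Finset.sum_le_sum fun S _ => ?_
        rw [← card_filter_formSupport_eq]
        exact Finset.card_le_card fun w hw => by
          rw [Finset.mem_filter] at hw ⊢
          exact ⟨Finset.mem_univ _, hw.2⟩
    _ = ∑ k ∈ Finset.range D, n.choose k • q ^ k := by
        rw [sum_powerset_filter_card_lt, Finset.card_univ, Fintype.card_fin]
    _ ≤ ∑ k ∈ Finset.range D, (n * m) ^ k := by
        refine Finset.sum_le_sum fun k _ => ?_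
        rw [smul_eq_mul, mul_pow]
        exact Nat.mul_le_mul (Nat.choose_le_pow n k) (Nat.pow_le_pow_left hqm k)
    _ ≤ _ := (Nat.geomSum_lt (by nlinarith) (by simp)).le

end PartialForms

/-! ### The depth-two circuit. -/

/-- Modulo the full power of `p` in `m` only the term of `p` survives, since `m / q` keeps that
power for `q ≠ p`, while `m / p` lacks exactly one factor `p`. -/
theorem natCast_dvd_sum_div_mul_iff {m : ℕ} (hm : m ≠ 0) (t : ℕ → ℤ) :
    (m : ℤ) ∣ ∑ p ∈ m.primeFactors, ((m / p : ℕ) : ℤ) * t p ↔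
      ∀ p ∈ m.primeFactors, (p : ℤ) ∣ t p := by
  constructor
  · intro h p hp
    have hpp := Nat.prime_of_mem_primeFactors hp
    obtain ⟨a, m', hm', hma⟩ := Nat.exists_eq_pow_mul_and_not_dvd hm p hpp.ne_one
    have ha : a ≠ 0 := by
      rintro rfl
      exact hm' (by simpa [hma] using Nat.dvd_of_mem_primeFactors hp)
    obtain ⟨b, rfl⟩ := Nat.exists_eq_succ_of_ne_zero ha
    have h1 : ((p ^ (b + 1) : ℕ) : ℤ) ∣ ((m / p : ℕ) : ℤ) * t p := by
      rw [← Finset.add_sum_erase _ _ hp] at h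
      refine (dvd_add_left (Finset.dvd_sum fun q hq => Dvd.dvd.mul_right ?_ _)).1
        ((Int.natCast_dvd_natCast.2 (Dvd.intro m' hma.symm)).trans h)
      rw [Finset.mem_erase] at hq
      have hqp := Nat.prime_of_mem_primeFactors hq.2
      have hcop : Nat.Coprime (p ^ (b + 1)) q :=
        Nat.Coprime.pow_left _ ((Nat.coprime_primes hpp hqp).2 hq.1.symm)
      refine Int.natCast_dvd_natCast.2 (hcop.dvd_of_dvd_mul_left ?_)
      rw [Nat.mul_div_cancel' (Nat.dvd_of_mem_primeFactors hq.2)]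
      exact Dvd.intro m' hma.symm
    have h2 : m / p = p ^ b * m' := by
      rw [hma, Nat.succ_eq_add_one, pow_succ', mul_assoc, Nat.mul_div_cancel_left _ hpp.pos]
    rw [h2, pow_succ] at h1
    push_cast at h1
    rw [mul_assoc] at h1
    have h3 := (mul_dvd_mul_iff_left
      (pow_ne_zero b (Int.natCast_ne_zero.2 hpp.ne_zero))).1 h1
    refine ((Nat.prime_iff_prime_int.1 hpp).dvd_or_dvd h3).resolve_left fun h4 => hm' ?_
    exact_mod_cast h4
  · intro h
    refine Finset.dvd_sum fun p hp => ?_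
    obtain ⟨s, hs⟩ := h p hp
    refine ⟨s, ?_⟩
    rw [hs, ← mul_assoc, ← Nat.cast_mul, Nat.div_mul_cancel (Nat.dvd_of_mem_primeFactors hp)]

/-- The gates of the middle layer of the depth-two circuit for the conjunction. -/
abbrev AndGate (m n : ℕ) (q D : ℕ → ℕ) : Type :=
  (p : m.primeFactors) ×
    ({w : Fin n → Option (Fin (q p)) // (formSupport w).card < D p} × Bool)

/-- The multiplicity modulo `m` of the wire from a middle gate to the root. -/
def andCoeff {m n : ℕ} {q D : ℕ → ℕ} (c : ℕ → ℕ) (g : AndGate m n q D) : ZMod m :=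
  ((m / g.1 : ℕ) : ZMod m) * (-(c g.1 : ZMod m)) ^ (formSupport g.2.1.1).card *
    if g.2.2 then -1 else 1

/-- The wires of the depth-two circuit for the conjunction. -/
def andWires {m n : ℕ} {q D : ℕ → ℕ} (c : ℕ → ℕ) :
    Fin n ⊕ Option (AndGate m n q D) → Fin n ⊕ Option (AndGate m n q D) → ℕ
  -- The summand `m` is invisible modulo `m` but makes every wire between consecutive layers
  -- present, even for the empty form.
  | Sum.inl i, Sum.inr (some g) => formCoeff g.2.1.1 i + m
  | Sum.inr (some g), Sum.inr none => (andCoeff c g).val + m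
  | _, _ => 0

/-- The layer of a gate. -/
def andLayer {m n : ℕ} {q D : ℕ → ℕ} : Fin n ⊕ Option (AndGate m n q D) → ℕ
  | Sum.inl _ => 0
  | Sum.inr (some _) => 1
  | Sum.inr none => 2

theorem andLayer_lt_of_andWires_pos {m n : ℕ} {q D : ℕ → ℕ} {c : ℕ → ℕ}
    {g h : Fin n ⊕ Option (AndGate m n q D)} (hgh : 0 < andWires c g h) :
    andLayer g < andLayer h := by
  rcases g with i | _ | g <;> rcases h with j | _ | h <;> simp_all [andWires, andLayer]

theorem andWires_le {m n : ℕ} (hm : m ≠ 0) {q D : ℕ → ℕ} (hq : ∀ p ∈ m.primeFactors, q p ≤ m)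
    {c : ℕ → ℕ} (g h : Fin n ⊕ Option (AndGate m n q D)) : andWires c g h ≤ 2 * m := by
  have : NeZero m := ⟨hm⟩
  rcases g with i | _ | g <;> rcases h with j | _ | h <;> simp only [andWires, Nat.zero_le]
  · have h1 : formCoeff h.2.1.1 i ≤ m := by
      unfold formCoeff
      cases h.2.1.1 i with
      | none => exact Nat.zero_le _
      | some a => exact a.2.le.trans (hq _ h.1.2)
    omega
  · have := (ZMod.val_lt (andCoeff c g)).le
    omega

/-- The middle gate of the empty linear form. -/
def emptyAndGate {m n : ℕ} {q D : ℕ → ℕ} (p : m.primeFactors) (hD : 0 < D p) :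
    AndGate m n q D :=
  ⟨p, ⟨fun _ => none, by simpa [formSupport] using hD⟩, true⟩

/-- A depth-two circuit for the conjunction. -/
noncomputable def andCircuit {m n : ℕ} (q D c : ℕ → ℕ) (hm : 2 ≤ m) (hn : 1 ≤ n)
    (hD : ∀ p, 0 < D p) : ModCircuit m n where
  Inner := Option (AndGate m n q D)
  accept
    -- The value reached exactly when each prime's signed count is `1` modulo `p`.
    | none => {∑ p ∈ m.primeFactors, ((m / p : ℕ) : ZMod m)}
    | some g => {z | (z.cast : ZMod (q g.1)) = if g.2.2 then 1 else 0}
  wires := andWires c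
  no_incoming_iff := by
    intro h
    constructor
    · intro hh
      rcases h with i | _ | g
      · exact ⟨i, rfl⟩
      · obtain ⟨p, hp⟩ := Nat.nonempty_primeFactors.2 (show 1 < m by omega)
        have := hh (Sum.inr (some (emptyAndGate ⟨p, hp⟩ (hD p))))
        simp only [andWires] at this
        omega
      · have := hh (Sum.inl ⟨0, hn⟩)
        simp only [andWires] at this
        omega
    · rintro ⟨i, rfl⟩ g
      rcases g with j | _ | g <;> rfl
  acyclic := by
    intro g hg
    have : ∀ h, Relation.TransGen (fun a b => 0 < andWires c a b) g h →
        andLayer g < andLayer h := by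
      intro h hgh
      induction hgh with
      | single h => exact andLayer_lt_of_andWires_pos h
      | tail _ h ih => exact ih.trans (andLayer_lt_of_andWires_pos h)
    exact lt_irrefl _ (this g hg)
  root := Sum.inr none

section AndCircuit

variable {m n : ℕ} {q D c : ℕ → ℕ} {hm : 2 ≤ m} {hn : 1 ≤ n} {hD : ∀ p, 0 < D p}

theorem hasDepth_andCircuit : (andCircuit q D c hm hn hD).HasDepth 2 := by
  constructor
  · obtain ⟨p, hp⟩ := Nat.nonempty_primeFactors.2 (show 1 < m by omega)
    let g : Fin n ⊕ Option (AndGate m n q D) :=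
      Sum.inr (some (emptyAndGate ⟨p, hp⟩ (hD p)))
    let s : RelSeries {e : (andCircuit q D c hm hn hD).Gate × (andCircuit q D c hm hn hD).Gate |
        (andCircuit q D c hm hn hD).IsWire e.1 e.2} :=
      ⟨2, ![Sum.inl ⟨0, hn⟩, g, Sum.inr none], fun i => by
        fin_cases i
        · change 0 < formCoeff _ _ + m
          omega
        · change 0 < (andCoeff c _).val + m
          omega⟩
    exact ⟨s, ⟨⟨0, hn⟩, rfl⟩, rfl, rfl⟩
  · rintro k ⟨s, -, hlast, rfl⟩
    have h : ∀ i : Fin (s.length + 1), (i : ℕ) ≤ andLayer (s i) := by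
      intro i
      induction i using Fin.induction with
      | zero => exact Nat.zero_le _
      | succ i ih =>
        have h1 : andLayer (s i.castSucc) < andLayer (s i.succ) :=
          andLayer_lt_of_andWires_pos (s.step i)
        rw [Fin.val_succ]
        rw [Fin.val_castSucc] at ih
        omega
    have h2 := h (Fin.last _)
    rw [Fin.val_last, show s (Fin.last _) = Sum.inr none from hlast] at h2
    exact h2

/-- All coefficient vectors of bounded support size occur, so permuting their coordinates permutes
the middle gates; the weights to the root depend only on the size of the support. -/
theorem isSymmetric_andCircuit : (andCircuit q D c hm hn hD).IsSymmetric ⊤ := by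
  intro π _
  have hsupp : ∀ (p : m.primeFactors) (w : Fin n → Option (Fin (q p))),
      (formSupport (w ∘ π.symm)).card = (formSupport w).card := by
    intro p w
    refine (Finset.card_bij (fun i _ => π i) (fun i hi => ?_) (fun i _ j _ h => π.injective h)
      fun i hi => ⟨π.symm i, ?_, π.apply_symm_apply i⟩).symm
    · simpa [formSupport] using hi
    · simpa [formSupport] using hi
  let σ : Equiv.Perm (AndGate m n q D) := Equiv.sigmaCongrRight fun p =>
    Equiv.prodCongr ((Equiv.arrowCongr π (Equiv.refl _)).subtypeEquiv fun w => by
      rw [show Equiv.arrowCongr π (Equiv.refl _) w = w ∘ π.symm from rfl, hsupp])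
      (Equiv.refl _)
  refine ⟨Equiv.sumCongr π (Equiv.optionCongr σ), fun g => ?_, fun g h => ?_⟩
  · rcases g with i | _ | g <;> rfl
  · rcases g with i | _ | g <;> rcases h with j | _ | h <;> try rfl
    · change formCoeff (h.2.1.1 ∘ π.symm) (π i) + m = formCoeff h.2.1.1 i + m
      rw [formCoeff, formCoeff, Function.comp_apply, Equiv.symm_apply_apply]
    · change (((m / g.1 : ℕ) : ZMod m) *
        (-(c g.1 : ZMod m)) ^ (formSupport (g.2.1.1 ∘ π.symm)).card *
        if g.2.2 then -1 else 1).val + m = (andCoeff c g).val + m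
      rw [hsupp, andCoeff]

/-- As `q p ∣ m`, reduction to `ZMod (q p)` is a ring homomorphism, so a gate modulo `m` can test a
form modulo `q p`. -/
theorem eval_andCircuit_some (hq : ∀ p ∈ m.primeFactors, q p ∣ m) (x : Fin n → Bool)
    (g : AndGate m n q D) :
    (andCircuit q D c hm hn hD).eval x (Sum.inr (some g)) = true ↔
      formValue g.2.1.1 x = if g.2.2 then 1 else 0 := by
  refine (ModCircuit.eval_inr (andCircuit q D c hm hn hD) x (some g)).trans ?_
  have h1 : (∑ h : (andCircuit q D c hm hn hD).Gate,
      ((andCircuit q D c hm hn hD).wires h (Sum.inr (some g)) : ZMod m) *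
        (((andCircuit q D c hm hn hD).eval x h).toNat : ZMod m)) =
      ∑ i, (formCoeff g.2.1.1 i : ZMod m) * ((x i).toNat : ZMod m) := by
    rw [Fintype.sum_sum_type]
    have h2 : ∀ j, (andCircuit q D c hm hn hD).wires (Sum.inr j) (Sum.inr (some g)) = 0 := by
      intro j; rcases j with _ | j <;> rfl
    have h3 : ∀ i, (andCircuit q D c hm hn hD).wires (Sum.inl i) (Sum.inr (some g)) =
        formCoeff g.2.1.1 i + m := fun i => rfl
    simp only [h2, h3, ModCircuit.eval_inl, Nat.cast_zero, zero_mul, Finset.sum_const_zero,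
      add_zero, Nat.cast_add, ZMod.natCast_self]
  rw [h1]
  have h4 : ZMod.castHom (hq _ g.1.2) (ZMod (q g.1))
      (∑ i, (formCoeff g.2.1.1 i : ZMod m) * ((x i).toNat : ZMod m)) =
        formValue g.2.1.1 x := by
    simp only [map_sum, map_mul, map_natCast]
    rfl
  rw [← h4]
  rfl

theorem computesAND_andCircuit {e : ℕ → ℕ}
    (hq : ∀ p ∈ m.primeFactors, q p ∈ m.primeFactors)
    (hc : ∀ p ∈ m.primeFactors, (c p : ZMod p) * (q p : ZMod p) = 1)
    (hDe : ∀ p ∈ m.primeFactors, D p = p ^ e p)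
    (hprod : n < ∏ p ∈ m.primeFactors, D p) :
    (andCircuit q D c hm hn hD).ComputesAND := by
  intro x
  have hqm : ∀ p ∈ m.primeFactors, q p ∣ m := fun p hp => Nat.dvd_of_mem_primeFactors (hq p hp)
  have hq1 : ∀ p ∈ m.primeFactors, 1 < q p := fun p hp =>
    (Nat.prime_of_mem_primeFactors (hq p hp)).one_lt
  set t : ℕ → ℤ := fun p =>
    ∑ w : Fin n → Option (Fin (q p)) with (formSupport w).card < D p,
      (-(c p : ℤ)) ^ (formSupport w).card *
        ((if formValue w x = 0 then 1 else 0) - (if formValue w x = 1 then 1 else 0)) with ht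
  have hsum : (∑ h : (andCircuit q D c hm hn hD).Gate,
      ((andCircuit q D c hm hn hD).wires h (Sum.inr none) : ZMod m) *
        (((andCircuit q D c hm hn hD).eval x h).toNat : ZMod m)) =
      ((∑ p ∈ m.primeFactors, ((m / p : ℕ) : ℤ) * t p : ℤ) : ZMod m) := by
    have hNe : NeZero m := ⟨by omega⟩
    rw [Fintype.sum_sum_type]
    have h0 : ∀ i, (andCircuit q D c hm hn hD).wires (Sum.inl i) (Sum.inr none) = 0 :=
      fun i => rfl
    simp only [h0, Nat.cast_zero, zero_mul, Finset.sum_const_zero, zero_add]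
    refine (Fintype.sum_option _).trans ?_
    have h1 : (andCircuit q D c hm hn hD).wires (Sum.inr none) (Sum.inr none) = 0 := rfl
    have h2 : ∀ g : AndGate m n q D,
        (andCircuit q D c hm hn hD).wires (Sum.inr (some g)) (Sum.inr none) =
          (andCoeff c g).val + m := fun g => rfl
    simp only [h1, h2, Nat.cast_zero, zero_mul, zero_add, Nat.cast_add, ZMod.natCast_self,
      add_zero, ZMod.natCast_val, ZMod.cast_id', id]
    have h3 : ∀ g : AndGate m n q D,
        andCoeff c g * (((andCircuit q D c hm hn hD).eval x (Sum.inr (some g))).toNat : ZMod m) =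
        andCoeff c g * if formValue g.2.1.1 x = (if g.2.2 then 1 else 0) then 1 else 0 := by
      intro g
      congr 1
      by_cases h : formValue g.2.1.1 x = if g.2.2 then 1 else 0
      · rw [(eval_andCircuit_some hqm x g).2 h, if_pos h]; simp
      · rw [if_neg h, Bool.eq_false_iff.2 fun h' => h ((eval_andCircuit_some hqm x g).1 h')]; simp
    rw [Finset.sum_congr rfl fun g _ => h3 g, Fintype.sum_sigma, Int.cast_sum,
      ← Finset.sum_coe_sort m.primeFactors]
    refine Finset.sum_congr rfl fun p _ => ?_
    rw [Fintype.sum_prod_type]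
    simp only [Fintype.sum_bool, andCoeff, if_true, Bool.false_eq_true, if_false]
    have htp : ((t p : ℤ) : ZMod m) =
        ∑ w : Fin n → Option (Fin (q p)) with (formSupport w).card < D p,
          (-(c p : ZMod m)) ^ (formSupport w).card *
            ((if formValue w x = 0 then 1 else 0) - (if formValue w x = 1 then 1 else 0)) := by
      rw [ht]
      push_cast
      rfl
    rw [Int.cast_mul, Int.cast_natCast, htp, Finset.mul_sum, Finset.sum_subtype (p := fun w : Fin n → Option (Fin (q p)) =>
      (formSupport w).card < D p) _ (by simp)]
    refine Finset.sum_congr rfl fun w _ => ?_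
    ring
  have hroot : (andCircuit q D c hm hn hD).eval x (andCircuit q D c hm hn hD).root = true ↔
      ((∑ p ∈ m.primeFactors, ((m / p : ℕ) : ℤ) * t p : ℤ) : ZMod m) =
        ∑ p ∈ m.primeFactors, ((m / p : ℕ) : ZMod m) := by
    rw [← hsum]
    exact ModCircuit.eval_inr (andCircuit q D c hm hn hD) x none
  have hroot' : (andCircuit q D c hm hn hD).eval x (andCircuit q D c hm hn hD).root = true ↔
      ∀ p ∈ m.primeFactors, (p : ℤ) ∣ t p - 1 := by
    rw [hroot, ← natCast_dvd_sum_div_mul_iff (by omega), ← ZMod.intCast_zmod_eq_zero_iff_dvd,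
      ← sub_eq_zero]
    simp only [Int.cast_sum, Int.cast_mul, Int.cast_natCast, Int.cast_sub, mul_sub,
      mul_one, Finset.sum_sub_distrib]
  rw [hroot']
  set z := (Finset.univ.filter fun i => x i = false).card with hz
  have hp : ∀ p ∈ m.primeFactors, ((p : ℤ) ∣ t p - 1 ↔ D p ∣ z) := by
    intro p hp
    have : Fact p.Prime := ⟨Nat.prime_of_mem_primeFactors hp⟩
    have h1 := sum_formSupport_card_lt (hq1 p hp) (hc p hp) (e p) x
    rw [← hDe p hp] at h1
    have h2 : ((t p : ℤ) : ZMod p) = if D p ∣ z then 1 else 0 := by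
      rw [← h1, ht]
      push_cast
      rfl
    rw [← ZMod.intCast_zmod_eq_zero_iff_dvd, Int.cast_sub, h2]
    split_ifs with h <;> simp [h]
  rw [forall₂_congr hp]
  have hz0 : z = 0 ↔ ∀ i, x i = true := by
    rw [hz, Finset.card_eq_zero, Finset.filter_eq_empty_iff]
    simp
  rw [← hz0]
  refine ⟨fun h => ?_, fun h p _ => h ▸ dvd_zero _⟩
  -- The `D p` are pairwise coprime and their product exceeds `n ≥ z`, which forces `z = 0`.
  have hdvd : ∏ p ∈ m.primeFactors, D p ∣ z := by
    refine Finset.prod_dvd_of_isRelPrime (fun p hp p' hp' hne => ?_) h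
    rw [Function.onFun, hDe p hp, hDe p' hp']
    exact (Nat.coprime_iff_isRelPrime.1 (Nat.coprime_pow_primes _ _
      (Nat.prime_of_mem_primeFactors hp) (Nat.prime_of_mem_primeFactors hp') hne))
  have hzn : z ≤ n := (Finset.card_le_univ _).trans (Fintype.card_fin n).le
  exact Nat.eq_zero_of_dvd_of_lt hdvd (hzn.trans_lt hprod)

theorem size_andCircuit_le {B : ℕ} (hq : ∀ p ∈ m.primeFactors, q p ≤ m)
    (hDB : ∀ p ∈ m.primeFactors, D p ≤ B) (hB : 1 ≤ B) :
    (andCircuit q D c hm hn hD).size ≤ 48 * m ^ 3 * (n * m) ^ (2 * B) := by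
  have hcard : Fintype.card (andCircuit q D c hm hn hD).Gate ≤ 4 * m * (n * m) ^ B := by
    have h1 : Fintype.card (andCircuit q D c hm hn hD).Gate =
        n + (Fintype.card (AndGate m n q D) + 1) := by
      rw [Fintype.card_sum, Fintype.card_fin]
      congr 1
      exact Fintype.card_option
    have h2 : Fintype.card (AndGate m n q D) ≤ m * ((n * m) ^ B * 2) := by
      rw [Fintype.card_sigma]
      calc _ ≤ ∑ p : m.primeFactors, (n * m) ^ B * 2 := by
            refine Finset.sum_le_sum fun p _ => ?_
            rw [Fintype.card_prod, Fintype.card_bool, Fintype.card_subtype]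
            refine Nat.mul_le_mul_right _ ((card_filter_formSupport_card_lt_le
              (hq p p.2) hm hn).trans ?_)
            exact Nat.pow_le_pow_right (by nlinarith) (hDB p p.2)
        _ = m.primeFactors.card * ((n * m) ^ B * 2) := by
            rw [Finset.sum_const, Finset.card_univ, Fintype.card_coe, smul_eq_mul]
        _ ≤ _ := by
            refine Nat.mul_le_mul_right _ ?_
            calc m.primeFactors.card ≤ (Finset.Icc 1 m).card := Finset.card_le_card fun p hp =>
                  Finset.mem_Icc.2 ⟨(Nat.prime_of_mem_primeFactors hp).one_lt.le,
                    Nat.le_of_dvd (by omega) (Nat.dvd_of_mem_primeFactors hp)⟩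
              _ = m := by simp
    have h3 : n * m ≤ (n * m) ^ B := Nat.le_self_pow (by omega) _
    have h5 : 2 * n ≤ n * m := by nlinarith
    have h6 : 1 * (n * m) ^ B ≤ m * (n * m) ^ B := Nat.mul_le_mul_right _ (by omega)
    rw [h1]
    linarith
  have hwires : ∑ g : (andCircuit q D c hm hn hD).Gate, ∑ h : (andCircuit q D c hm hn hD).Gate,
      (andCircuit q D c hm hn hD).wires g h ≤
      Fintype.card (andCircuit q D c hm hn hD).Gate *
        (Fintype.card (andCircuit q D c hm hn hD).Gate * (2 * m)) := by
    rw [← smul_eq_mul, ← smul_eq_mul (Fintype.card _) (2 * m)]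
    refine Finset.sum_le_card_nsmul _ _ _ fun g _ => ?_
    exact Finset.sum_le_card_nsmul _ _ _ fun h _ => andWires_le (by omega) hq g h
  rw [ModCircuit.size]
  set G := Fintype.card (andCircuit q D c hm hn hD).Gate
  have h4 : 1 ≤ (n * m) ^ B := Nat.one_le_pow _ _ (by nlinarith)
  calc _ ≤ G + G * (G * (2 * m)) := Nat.add_le_add_left hwires _
    _ ≤ 4 * m * (n * m) ^ B + 4 * m * (n * m) ^ B * (4 * m * (n * m) ^ B * (2 * m)) := by gcongr
    _ = 4 * m * (n * m) ^ B * 1 + 32 * m ^ 3 * (n * m) ^ (2 * B) := by ring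
    _ ≤ 4 * m * (n * m) ^ B * (4 * m ^ 2 * (n * m) ^ B) + 32 * m ^ 3 * (n * m) ^ (2 * B) := by
        gcongr
        have : 1 ≤ m ^ 2 := Nat.one_le_pow _ _ (by omega)
        nlinarith
    _ = _ := by ring

end AndCircuit

/-! ### The upper bound. -/

/-- The upper bound on the size of symmetric depth-two circuits for the conjunction. -/
theorem ModCircuit.exists_size_le_two_rpow {m r : ℕ} (hr : 2 ≤ r)
    (hmr : m.primeFactors.card = r) :
    ∃ K : ℝ, 0 < K ∧ ∃ N : ℕ, ∀ n : ℕ, 1 ≤ n → ∃ C : ModCircuit m n,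
      C.HasDepth 2 ∧ C.IsSymmetric ⊤ ∧ C.ComputesAND ∧
        (N ≤ n → (C.size : ℝ) ≤ (2 : ℝ) ^ (K * ((n : ℝ) ^ (1 / (r : ℝ)) * Real.log n))) := by
  have hm : 2 ≤ m := by
    by_contra! h
    interval_cases m <;> simp at hmr <;> omega
  have hr0 : (0 : ℝ) < r := by exact_mod_cast (by omega : 0 < r)
  have hm0 : (0 : ℝ) < m := by exact_mod_cast (by omega : 0 < m)
  obtain ⟨q, hq⟩ : ∃ q : ℕ → ℕ, ∀ p ∈ m.primeFactors, q p ∈ m.primeFactors ∧ q p ≠ p := by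
    have : ∀ p, ∃ q, q ∈ m.primeFactors ∧ q ≠ p := fun p =>
      Finset.exists_mem_ne (by omega) p
    choose q hq using this
    exact ⟨q, fun p _ => hq p⟩
  set c : ℕ → ℕ := fun p => ((q p : ZMod p)⁻¹).val with hcdef
  have hc : ∀ p ∈ m.primeFactors, (c p : ZMod p) * (q p : ZMod p) = 1 := by
    intro p hp
    have hpp := Nat.prime_of_mem_primeFactors hp
    have : Fact p.Prime := ⟨hpp⟩
    rw [hcdef, ZMod.natCast_zmod_val]
    refine inv_mul_cancel₀ fun h => ?_
    rw [ZMod.natCast_eq_zero_iff] at h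
    exact (hq p hp).2
      ((Nat.prime_dvd_prime_iff_eq hpp (Nat.prime_of_mem_primeFactors (hq p hp).1)).1 h).symm
  -- `32 = 8 * 2 * 2`: the size is at most `n ^ (8 * (m * t))`, with `t ≤ 2 * n ^ (1 / r)` and `e ≤
  -- 2 ^ 2`. The threshold absorbs `48 * m ^ 3` into `n ^ 4`.
  refine ⟨32 * m, by positivity, max m 48, fun n hn => ?_⟩
  set t := ⌊(n : ℝ) ^ (1 / (r : ℝ))⌋₊ + 1 with ht
  have hn0 : (1 : ℝ) ≤ n := by exact_mod_cast hn
  have hy1 : 1 ≤ (n : ℝ) ^ (1 / (r : ℝ)) := Real.one_le_rpow hn0 (by positivity)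
  have ht1 : (n : ℝ) ^ (1 / (r : ℝ)) < t := by
    rw [ht]; push_cast; exact Nat.lt_floor_add_one _
  have ht2 : (t : ℝ) ≤ 2 * (n : ℝ) ^ (1 / (r : ℝ)) := by
    have := Nat.floor_le (zero_le_one.trans hy1)
    rw [ht]; push_cast; linarith
  have htr : n < t ^ r := by
    have : ((n : ℝ) ^ (1 / (r : ℝ))) ^ r < (t : ℝ) ^ r :=
      pow_lt_pow_left₀ ht1 (by positivity) (by omega)
    rw [← Real.rpow_natCast, ← Real.rpow_mul (by positivity), one_div_mul_cancel hr0.ne',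
      Real.rpow_one] at this
    exact_mod_cast this
  -- The maximum only serves positivity at `p = 0`; for primes `p ∣ m` the value lies between `t`
  -- and `m * t`.
  set D : ℕ → ℕ := fun p => (max p 1) ^ Nat.clog p t with hDdef
  have hD : ∀ p, 0 < D p := fun p => Nat.pow_pos (by omega)
  have hDe : ∀ p ∈ m.primeFactors, D p = p ^ Nat.clog p t := fun p hp => by
    rw [hDdef]
    simp only
    rw [max_eq_left (Nat.prime_of_mem_primeFactors hp).one_lt.le]
  have hDt : ∀ p ∈ m.primeFactors, t ≤ D p := fun p hp => by
    rw [hDe p hp]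
    exact Nat.le_pow_clog (Nat.prime_of_mem_primeFactors hp).one_lt t
  have hDmt : ∀ p ∈ m.primeFactors, D p ≤ m * t := fun p hp => by
    have hp1 := (Nat.prime_of_mem_primeFactors hp).one_lt
    have hpm : p ≤ m := Nat.le_of_dvd (by omega) (Nat.dvd_of_mem_primeFactors hp)
    rw [hDe p hp]
    rcases Nat.eq_zero_or_pos (Nat.clog p t) with h | h
    · rw [h, pow_zero]
      exact Nat.mul_pos (by omega) (by omega)
    · have h3 := (Nat.pow_lt_of_lt_clog (b := p) (x := t) (y := Nat.clog p t - 1)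
        (by omega)).le
      calc p ^ Nat.clog p t = p * p ^ (Nat.clog p t - 1) := by
            rw [← pow_succ']; congr 1; omega
        _ ≤ m * t := Nat.mul_le_mul hpm h3
  have hprod : n < ∏ p ∈ m.primeFactors, D p := by
    refine htr.trans_le ?_
    rw [← hmr, ← Finset.prod_const]
    exact Finset.prod_le_prod' hDt
  have hqm : ∀ p ∈ m.primeFactors, q p ≤ m := fun p hp =>
    Nat.le_of_dvd (by omega) (Nat.dvd_of_mem_primeFactors (hq p hp).1)
  refine ⟨andCircuit q D c hm hn hD, hasDepth_andCircuit, isSymmetric_andCircuit,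
    computesAND_andCircuit (fun p hp => (hq p hp).1) hc hDe hprod, fun hN => ?_⟩
  have hmn : m ≤ n := (le_max_left _ _).trans hN
  have hn48 : 48 ≤ n := (le_max_right _ _).trans hN
  have hB : 1 ≤ m * t := Nat.mul_pos (by omega) (by omega)
  have h1 : (andCircuit q D c hm hn hD).size ≤ n ^ (8 * (m * t)) := by
    refine (size_andCircuit_le hqm hDmt hB).trans ?_
    calc 48 * m ^ 3 * (n * m) ^ (2 * (m * t)) ≤ n * n ^ 3 * (n * n) ^ (2 * (m * t)) := by gcongr
      _ = n ^ (4 + 4 * (m * t)) := by ring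
      _ ≤ n ^ (8 * (m * t)) := Nat.pow_le_pow_right hn (by omega)
  have hlog : 0 ≤ Real.log n := Real.log_natCast_nonneg n
  have hexp : Real.exp 1 ≤ 2 ^ (2 : ℝ) := by
    have := Real.exp_one_lt_d9
    norm_num
    linarith
  calc ((andCircuit q D c hm hn hD).size : ℝ) ≤ (n : ℝ) ^ (8 * (m * t)) := by exact_mod_cast h1
    _ = Real.exp 1 ^ (Real.log n * (8 * (m * t))) := by
        rw [Real.exp_one_rpow, ← Real.rpow_natCast, Real.rpow_def_of_pos (by linarith)]
        push_cast
        rfl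
    _ ≤ (2 ^ (2 : ℝ)) ^ (Real.log n * (8 * (m * t))) :=
        Real.rpow_le_rpow (by positivity) hexp (by positivity)
    _ = 2 ^ (16 * (m * t) * Real.log n) := by
        rw [← Real.rpow_mul (by norm_num)]
        congr 1
        ring
    _ ≤ _ := by
        refine Real.rpow_le_rpow_of_exponent_le (by norm_num) ?_
        calc 16 * (m * t) * Real.log n ≤ 16 * (m * (2 * (n : ℝ) ^ (1 / (r : ℝ)))) * Real.log n := by
              gcongr
          _ = _ := by ring

theorem theorem1 (m r : ℕ) (hm : 6 ≤ m) (hr : 2 ≤ r) (hmr : m.primeFactors.card = r) :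
    (∃ c : ℝ, 0 < c ∧ ∃ N : ℕ, ∀ n : ℕ, N ≤ n → ∀ C : ModCircuit m n,
      C.IsSymmetric ⊤ → C.ComputesAND →
        (2 : ℝ) ^ (c * ((n : ℝ) ^ (1 / (r : ℝ)) * Real.log n)) ≤ (C.size : ℝ)) ∧
    (∃ K : ℝ, 0 < K ∧ ∃ N : ℕ, ∀ n : ℕ, 1 ≤ n → ∃ C : ModCircuit m n,
      C.HasDepth 2 ∧ C.IsSymmetric ⊤ ∧ C.ComputesAND ∧
        (N ≤ n → (C.size : ℝ) ≤ (2 : ℝ) ^ (K * ((n : ℝ) ^ (1 / (r : ℝ)) * Real.log n)))) :=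
  ⟨ModCircuit.exists_two_rpow_le_size (by omega) hr hmr,
    ModCircuit.exists_size_le_two_rpow hr hmr⟩
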